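/- Let $k$ be a field, let $S$ be a linear algebraic group over $k$ (for example a reductive one), let $\Gamma$ be a group, and let $\rho:\Gamma\to S$ be a surjective homomorphism which splits, i.e. there is a group homomorphism $s:S\to\Gamma$ with $\rho\circ s=\mathrm{id}_S$. (Linear algebraic groups over $k$ are Zariski closed subgroups of some $GL_n(k)$, with regular functions the restrictions of elements of $k[GL_n]$.) Let $\mathcal G=\varprojlim_\alpha G_\alpha$ be the completion of $\Gamma$ relative to $\rho$: the inverse limit runs over all extensions of linear algebraic groups over $k$ $$1\to U_\alpha\to G_\alpha\to S\to 1$$ with $U_\alpha$ unipotent, equipped with a homomorphism $\tilde\rho_\alpha:\Gamma\to G_\alpha$ with Zariski dense image which lifts $\rho$. Let $\mathcal U=\ker(\mathcal G\to S)$, let $T=\ker\rho$, let $\mathcal T$ be the unipotent $k$-completion of $T$ (the completion of $T$ relative to the homomorphism to the trivial group), and let $\Phi:\mathcal T\to\mathcal U$ be the homomorphism induced by $T\to\mathcal U$. Put $$H^2_{\mathrm{cts}}(\mathcal G,k)=\varinjlim_\alpha H^2(G_\alpha,k),$$ where $H^2(G_\alpha,k)$ is the cohomology of the algebraic group $G_\alpha$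 with trivial coefficients $k$, computed by inhomogeneous cochains that are regular functions (so that it classifies the extensions of $G_\alpha$ by the additive group in the category of algebraic groups). If $k$ is finite, this is the ordinary group cohomology of $G_\alpha$. Assume that $H_1(T,k)$ is finite dimensional over $k$ and that $\Phi:\mathcal T\to\mathcal U$ is an isomorphism. Then the restriction map $$H^2_{\mathrm{cts}}(\mathcal G,k)\longrightarrow H^2(\Gamma,k),$$ induced by the homomorphisms $\tilde\rho_\alpha$, into the ordinary group cohomology of $\Gamma$, is injective. -/

import Mathlib

universe u

noncomputable section

namespace RelComp

/-! ### Linear algebraic groups over a field, as Zariski closed subgroups of `GL_n(k)` -/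

/-- The coordinate ring `k[GL_n]`: the `k`-algebra of functions on `GL_n(k)` generated by the
entries of `g` and the entries of `g⁻¹`. -/
def glRegular (k : Type u) [Field k] (n : ℕ) :
    Subalgebra k (Matrix.GeneralLinearGroup (Fin n) k → k) :=
  Algebra.adjoin k
    ({f | ∃ i j, f = fun g : Matrix.GeneralLinearGroup (Fin n) k =>
        (g : Matrix (Fin n) (Fin n) k) i j} ∪
     {f | ∃ i j, f = fun g : Matrix.GeneralLinearGroup (Fin n) k =>
        ((g⁻¹ : Matrix.GeneralLinearGroup (Fin n) k) : Matrix (Fin n) (Fin n) k) i j})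

/-- A linear algebraic group over `k`: a Zariski closed subgroup of some `GL_n(k)`. -/
structure LinAlgGroup (k : Type u) [Field k] where
  n : ℕ
  points : Subgroup (Matrix.GeneralLinearGroup (Fin n) k)
  isClosed : ∃ F : Set (Matrix.GeneralLinearGroup (Fin n) k → k),
    F ⊆ glRegular k n ∧ ∀ g, g ∈ points ↔ ∀ f ∈ F, f g = 0

/-- Restriction of functions from `GL_n(k)` to a subgroup. -/
def restrictFun {k : Type u} [Field k] {n : ℕ}
    (H : Subgroup (Matrix.GeneralLinearGroup (Fin n) k)) :
    (Matrix.GeneralLinearGroup (Fin n) k → k) →ₐ[k] (H → k) :=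
  AlgHom.pi fun x => Pi.evalAlgHom k _ (x : Matrix.GeneralLinearGroup (Fin n) k)

/-- The coordinate ring of `G`: restrictions to `G` of the regular functions on `GL_n`. -/
def LinAlgGroup.regular {k : Type u} [Field k] (G : LinAlgGroup k) :
    Subalgebra k (G.points → k) :=
  (glRegular k G.n).map (restrictFun G.points)

theorem LinAlgGroup.mem_regular {k : Type u} [Field k] {G : LinAlgGroup k} {f : G.points → k} :
    f ∈ G.regular ↔ ∃ F ∈ glRegular k G.n, ∀ g : G.points, F g = f g :=
  ⟨fun ⟨F, hF, h⟩ => ⟨F, hF, fun g => congrFun h g⟩, fun ⟨F, hF, h⟩ => ⟨F, hF, funext h⟩⟩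

/-- A group homomorphism is algebraic if it pulls regular functions back to regular functions. -/
def IsAlgebraicHom {k : Type u} [Field k] {G H : LinAlgGroup k}
    (φ : G.points →* H.points) : Prop :=
  ∀ f ∈ H.regular, (fun g => f (φ g)) ∈ G.regular

/-- A homomorphism from an abstract group has Zariski dense image if a regular function which
vanishes on the image is zero. -/
def HasDenseImage {k : Type u} [Field k] {Γ : Type u} [Group Γ] {G : LinAlgGroup k}
    (ρ : Γ →* G.points) : Prop :=
  ∀ f ∈ G.regular, (∀ γ, f (ρ γ) = 0) → f = 0

/-- The ideal of `k[G]` which cuts out the kernel of an algebraic homomorphism `π : G → H` (as a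
closed subgroup scheme of `G`): it is generated by the pullbacks of the regular functions on `H`
vanishing at `1`. -/
def kernelIdeal {k : Type u} [Field k] {G H : LinAlgGroup k} (π : G.points →* H.points) :
    Ideal G.regular :=
  Ideal.span {f | ∃ h ∈ H.regular, h 1 = 0 ∧ ∀ g, (f : G.points → k) g = h (π g)}

/-- The kernel `U` of `π : G → H` is a unipotent subgroup of `G ⊆ GL(V)`, `V = k^n`: there is a
filtration `V = V 0 ⊇ V 1 ⊇ ... ⊇ V m = 0` such that `U` acts trivially on each `V i / V (i+1)`.
Triviality of the action is expressed through coordinate functions: for `v ∈ V i` and a linear form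
`ℓ` killing `V (i+1)`, the function `g ↦ ℓ (g v - v)` is zero on `U`, i.e. lies in the ideal of
`U`. (So it holds for the points of `U` over every extension of `k`, not only over `k`.) -/
def HasUnipotentKernel {k : Type u} [Field k] {G H : LinAlgGroup k}
    (π : G.points →* H.points) : Prop :=
  ∃ (m : ℕ) (V : ℕ → Submodule k (Fin G.n → k)), V 0 = ⊤ ∧ Antitone V ∧ V m = ⊥ ∧
    ∀ i, ∀ v ∈ V i, ∀ ℓ : Module.Dual k (Fin G.n → k), (∀ w ∈ V (i + 1), ℓ w = 0) →
      ∃ f ∈ kernelIdeal π, ∀ g : G.points, (f : G.points → k) g =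
        ℓ (((g : Matrix.GeneralLinearGroup (Fin G.n) k) : Matrix (Fin G.n) (Fin G.n) k).mulVec v
          - v)

/-- The trivial group. -/
def trivialGroup (k : Type u) [Field k] : LinAlgGroup k where
  n := 0
  points := ⊤
  isClosed := ⟨∅, Set.empty_subset _, by simp⟩

/-! ### The inverse system defining the relative completion -/

/-- A commutative diagram `1 → U → E → S → 1` with `E` a linear algebraic group, `U` unipotent,
together with a lift `Γ → E` of `ρ : Γ → S` with Zariski dense image. -/
structure Diagram {k : Type u} [Field k] {Γ : Type u} [Group Γ] (S : LinAlgGroup k)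
    (ρ : Γ →* S.points) where
  E : LinAlgGroup k
  π : E.points →* S.points
  algebraic : IsAlgebraicHom π
  surjective : Function.Surjective π
  unipotent : HasUnipotentKernel π
  lift : Γ →* E.points
  dense : HasDenseImage lift
  comm : ∀ γ, π (lift γ) = ρ γ

section System

variable {k : Type u} [Field k] {Γ : Type u} [Group Γ] {S : LinAlgGroup k} {ρ : Γ →* S.points}

/-- Morphisms of diagrams: algebraic homomorphisms over `S` and under `Γ`. -/
structure Diagram.IsHom (α β : Diagram S ρ) (φ : α.E.points →* β.E.points) : Prop where
  algebraic : IsAlgebraicHom φ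
  map_lift : ∀ γ, φ (α.lift γ) = β.lift γ
  map_π : ∀ x, β.π (φ x) = α.π x

/-- The index order of the inverse system: `α ≤ β` if there is a morphism of diagrams `β → α`
(it is then unique, by density of the image of `Γ`). -/
instance : Preorder (Diagram S ρ) where
  le α β := ∃ φ : β.E.points →* α.E.points, Diagram.IsHom β α φ
  le_refl α := ⟨MonoidHom.id _, ⟨fun _ hf => hf, fun _ => rfl, fun _ => rfl⟩⟩
  le_trans α β γ := by
    rintro ⟨φ, hφ⟩ ⟨ψ, hψ⟩
    refine ⟨φ.comp ψ, ⟨fun f hf => ?_, fun g => ?_, fun x => ?_⟩⟩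
    · exact hψ.algebraic _ (hφ.algebraic f hf)
    · simp [hψ.map_lift, hφ.map_lift]
    · simp [hψ.map_π, hφ.map_π]

variable (S ρ)

/-- The completion of `Γ` relative to `ρ : Γ → S`: the inverse limit of the groups `E` over all
diagrams. -/
def completion : Subgroup ((α : Diagram S ρ) → α.E.points) where
  carrier := {x | ∀ (α β : Diagram S ρ) (φ : α.E.points →* β.E.points),
    Diagram.IsHom α β φ → φ (x α) = x β}
  mul_mem' := by
    intro x y hx hy α β φ h
    simp [hx α β φ h, hy α β φ h]
  one_mem' := by
    intro α β φ _
    simp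
  inv_mem' := by
    intro x hx α β φ h
    simp [hx α β φ h]

/-- The canonical homomorphism from `Γ` to its completion. -/
def toCompletion : Γ →* completion S ρ where
  toFun γ := ⟨fun α => α.lift γ, fun _ _ _ h => h.map_lift γ⟩
  map_one' := by ext1; funext α; simp
  map_mul' x y := by ext1; funext α; simp

/-- The prounipotent radical: the kernel of the projection from the completion to `S`. -/
def prounipotentRadical : Subgroup (completion S ρ) where
  carrier := {x | ∀ α : Diagram S ρ, α.π (x.1 α) = 1}
  mul_mem' := by
    intro x y hx hy α
    simp [hx α, hy α]
  one_mem' := by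
    intro α
    simp
  inv_mem' := by
    intro x hx α
    simp [hx α]

end System

/-- The unipotent `k`-completion of a group: the case where `S` is the trivial group. -/
abbrev unipotentCompletion (k : Type u) [Field k] (T : Type u) [Group T] :
    Subgroup ((α : Diagram (trivialGroup k) (1 : T →* (trivialGroup k).points)) → α.E.points) :=
  completion (trivialGroup k) (1 : T →* (trivialGroup k).points)

/-! ### Zariski closure of the image of a homomorphism -/

section Closure

variable {k : Type u} [Field k] {n : ℕ}

theorem glRegular_inv {f : Matrix.GeneralLinearGroup (Fin n) k → k} (hf : f ∈ glRegular k n) :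
    (fun g => f g⁻¹) ∈ glRegular k n := by
  induction hf using Algebra.adjoin_induction with
  | mem f hf =>
    rcases hf with ⟨i, j, rfl⟩ | ⟨i, j, rfl⟩
    · exact Algebra.subset_adjoin (Or.inr ⟨i, j, rfl⟩)
    · exact Algebra.subset_adjoin (Or.inl ⟨i, j, by simp⟩)
  | algebraMap r => exact (glRegular k n).algebraMap_mem r
  | add f g _ _ h1 h2 => exact (glRegular k n).add_mem h1 h2
  | mul f g _ _ h1 h2 => exact (glRegular k n).mul_mem h1 h2

theorem glRegular_mul_right {f : Matrix.GeneralLinearGroup (Fin n) k → k}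
    (hf : f ∈ glRegular k n) (h : Matrix.GeneralLinearGroup (Fin n) k) :
    (fun g => f (g * h)) ∈ glRegular k n := by
  induction hf using Algebra.adjoin_induction with
  | mem f hf =>
    rcases hf with ⟨i, j, rfl⟩ | ⟨i, j, rfl⟩
    · have : (fun g : Matrix.GeneralLinearGroup (Fin n) k =>
          ((g * h : Matrix.GeneralLinearGroup (Fin n) k) : Matrix (Fin n) (Fin n) k) i j) =
          ∑ l, (h : Matrix (Fin n) (Fin n) k) l j •
            (fun g : Matrix.GeneralLinearGroup (Fin n) k => (g : Matrix (Fin n) (Fin n) k) i l) := by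
        funext g
        simp [Matrix.mul_apply, mul_comm]
      rw [this]
      exact (glRegular k n).sum_mem fun l _ => (glRegular k n).smul_mem
        (Algebra.subset_adjoin (Or.inl ⟨i, l, rfl⟩)) _
    · have : (fun g : Matrix.GeneralLinearGroup (Fin n) k =>
          (((g * h)⁻¹ : Matrix.GeneralLinearGroup (Fin n) k) : Matrix (Fin n) (Fin n) k) i j) =
          ∑ l, ((h⁻¹ : Matrix.GeneralLinearGroup (Fin n) k) : Matrix (Fin n) (Fin n) k) i l •
            (fun g : Matrix.GeneralLinearGroup (Fin n) k =>
              ((g⁻¹ : Matrix.GeneralLinearGroup (Fin n) k) : Matrix (Fin n) (Fin n) k) l j) := by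
        funext g
        rw [mul_inv_rev, Units.val_mul, Matrix.mul_apply]
        simp only [Finset.sum_apply, Pi.smul_apply, smul_eq_mul]
      rw [this]
      exact (glRegular k n).sum_mem fun l _ => (glRegular k n).smul_mem
        (Algebra.subset_adjoin (Or.inr ⟨l, j, rfl⟩)) _
  | algebraMap r => exact (glRegular k n).algebraMap_mem r
  | add f g _ _ h1 h2 => exact (glRegular k n).add_mem h1 h2
  | mul f g _ _ h1 h2 => exact (glRegular k n).mul_mem h1 h2

theorem glRegular_mul_left {f : Matrix.GeneralLinearGroup (Fin n) k → k}
    (hf : f ∈ glRegular k n) (h : Matrix.GeneralLinearGroup (Fin n) k) :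
    (fun g => f (h * g)) ∈ glRegular k n := by
  have := glRegular_inv (glRegular_mul_right (glRegular_inv hf) h⁻¹)
  simpa using this

/-- The Zariski closure in `GL_n(k)` of the image of a homomorphism, as a subgroup. -/
def closureSubgroup {T : Type u} [Group T] (τ : T →* Matrix.GeneralLinearGroup (Fin n) k) :
    Subgroup (Matrix.GeneralLinearGroup (Fin n) k) where
  carrier := {g | ∀ f ∈ glRegular k n, (∀ t, f (τ t) = 0) → f g = 0}
  one_mem' := fun f _ h => by simpa using h 1
  inv_mem' := by
    intro g hg f hf h
    refine hg _ (glRegular_inv hf) fun t => ?_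
    have := h t⁻¹
    rwa [map_inv] at this
  mul_mem' := by
    intro a b ha hb f hf h
    refine ha _ (glRegular_mul_right hf b) fun t => ?_
    refine hb _ (glRegular_mul_left hf (τ t)) fun s => ?_
    have := h (t * s)
    rwa [map_mul] at this

/-- The Zariski closure of the image of a homomorphism, as a linear algebraic group. -/
def zariskiClosure {T : Type u} [Group T] (τ : T →* Matrix.GeneralLinearGroup (Fin n) k) :
    LinAlgGroup k where
  n := n
  points := closureSubgroup τ
  isClosed := ⟨{f | f ∈ glRegular k n ∧ ∀ t, f (τ t) = 0}, fun _ hf => hf.1,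
    fun _ => ⟨fun h f hf => h f hf.1 hf.2, fun h f h1 h2 => h f ⟨h1, h2⟩⟩⟩

/-- The homomorphism from `T` to the Zariski closure of its image. -/
def toZariskiClosure {T : Type u} [Group T] (τ : T →* Matrix.GeneralLinearGroup (Fin n) k) :
    T →* (zariskiClosure τ).points :=
  τ.codRestrict (closureSubgroup τ) fun t _ _ h => h t

theorem toZariskiClosure_dense {T : Type u} [Group T]
    (τ : T →* Matrix.GeneralLinearGroup (Fin n) k) : HasDenseImage (toZariskiClosure τ) := by
  rintro _ ⟨f, hf, rfl⟩ h
  funext g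
  exact g.2 f hf h

end Closure

/-! ### The homomorphism `Φ` -/

section Phi

variable {k : Type u} [Field k] {Γ : Type u} [Group Γ] {S : LinAlgGroup k} {ρ : Γ →* S.points}

/-- The map `T → E ⊆ GL_n(k)` for `T = ker ρ`. -/
def Diagram.kerMap (α : Diagram S ρ) :
    ρ.ker →* Matrix.GeneralLinearGroup (Fin α.E.n) k :=
  (α.E.points.subtype.comp α.lift).comp ρ.ker.subtype

theorem Diagram.closure_le (α : Diagram S ρ) :
    closureSubgroup α.kerMap ≤ α.E.points := by
  obtain ⟨F, hF, hE⟩ := α.E.isClosed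
  intro g hg
  exact (hE g).2 fun f hf => hg f (hF hf) fun t => (hE _).1 (α.lift t).2 f hf

/-- A regular function on `E` vanishing on the image of `T` vanishes on its closure. -/
theorem Diagram.closure_vanish (α : Diagram S ρ) {f : α.E.points → k} (hf : f ∈ α.E.regular)
    (h : ∀ t : ρ.ker, f (α.lift t) = 0) (g : closureSubgroup α.kerMap) :
    f ⟨g.1, α.closure_le g.2⟩ = 0 := by
  obtain ⟨f, hf, rfl⟩ := hf
  exact g.2 f hf h

theorem Diagram.closure_ker (α : Diagram S ρ) (g : closureSubgroup α.kerMap) :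
    α.π ⟨g.1, α.closure_le g.2⟩ = 1 := by
  have key : ∀ i j, ((α.π ⟨g.1, α.closure_le g.2⟩ : Matrix.GeneralLinearGroup (Fin S.n) k) :
      Matrix (Fin S.n) (Fin S.n) k) i j = (1 : Matrix (Fin S.n) (Fin S.n) k) i j := by
    intro i j
    have hr : (fun x : S.points => ((x : Matrix.GeneralLinearGroup (Fin S.n) k) :
        Matrix (Fin S.n) (Fin S.n) k) i j) ∈ S.regular :=
      ⟨_, Algebra.subset_adjoin (Or.inl ⟨i, j, rfl⟩), rfl⟩
    have hr' := S.regular.sub_mem hr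
      (S.regular.algebraMap_mem ((1 : Matrix (Fin S.n) (Fin S.n) k) i j))
    have := α.closure_vanish (α.algebraic _ hr') (fun t => by
      rw [α.comm, (MonoidHom.mem_ker).1 t.2]
      simp) g
    simpa [sub_eq_zero] using this
  apply Subtype.ext
  apply Units.ext
  ext i j
  simpa using key i j

/-- A diagram for `ρ : Γ → S` gives one for `T = ker ρ` over the trivial group, namely the Zariski
closure of the image of `T`, a unipotent group. -/
def Diagram.resKer (α : Diagram S ρ) :
    Diagram (trivialGroup k) (1 : ρ.ker →* (trivialGroup k).points) where
  E := zariskiClosure α.kerMap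
  π := 1
  algebraic f _ := (zariskiClosure α.kerMap).regular.algebraMap_mem (f 1)
  surjective s := ⟨1, Subtype.ext (Units.ext (Matrix.ext fun i => i.elim0))⟩
  unipotent := by
    obtain ⟨m, V, h0, hanti, hm, hV⟩ := α.unipotent
    refine ⟨m, V, h0, hanti, hm, fun i v hv ℓ hℓ => ⟨0, Ideal.zero_mem _, fun (g : closureSubgroup α.kerMap) => ?_⟩⟩
    obtain ⟨f, hf, hfg⟩ := hV i v hv ℓ hℓ
    have hz : ∀ f ∈ kernelIdeal α.π, (f : α.E.points → k) ⟨g.1, α.closure_le g.2⟩ = 0 := by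
      intro f hf
      induction hf using Submodule.span_induction with
      | mem f hf =>
        obtain ⟨h, _, h1, hfh⟩ := hf
        rw [hfh, α.closure_ker, h1]
      | zero => rfl
      | add a b _ _ ha hb =>
        change (a : α.E.points → k) _ + (b : α.E.points → k) _ = 0
        rw [ha, hb, add_zero]
      | smul a b _ hb =>
        change (a : α.E.points → k) _ * (b : α.E.points → k) _ = 0
        rw [hb, mul_zero]
    have := hz f hf
    rw [hfg] at this
    exact this.symm
  lift := toZariskiClosure α.kerMap
  dense := toZariskiClosure_dense α.kerMap
  comm _ := rfl

theorem Diagram.IsHom.map_closure {α β : Diagram S ρ} {φ : α.E.points →* β.E.points}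
    (h : Diagram.IsHom α β φ) (g : closureSubgroup α.kerMap) :
    ((φ ⟨g.1, α.closure_le g.2⟩ : β.E.points) : Matrix.GeneralLinearGroup (Fin β.E.n) k) ∈
      closureSubgroup β.kerMap := by
  intro f hf hv
  refine α.closure_vanish (h.algebraic (restrictFun _ f) ⟨f, hf, rfl⟩) (fun t => ?_) g
  rw [h.map_lift]
  exact hv t

/-- A morphism of diagrams induces one between the closures of the image of `T`. -/
def Diagram.closureMap {α β : Diagram S ρ} {φ : α.E.points →* β.E.points}
    (h : Diagram.IsHom α β φ) : closureSubgroup α.kerMap →* closureSubgroup β.kerMap where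
  toFun g := ⟨φ ⟨g.1, α.closure_le g.2⟩, h.map_closure g⟩
  map_one' := Subtype.ext (congrArg β.E.points.subtype (map_one φ))
  map_mul' a b := by
    have h := map_mul φ ⟨a.1, α.closure_le a.2⟩ ⟨b.1, α.closure_le b.2⟩
    exact Subtype.ext (congrArg β.E.points.subtype h)

theorem Diagram.IsHom.exists_glRegular {α β : Diagram S ρ} {φ : α.E.points →* β.E.points}
    (h : Diagram.IsHom α β φ) (f : Matrix.GeneralLinearGroup (Fin β.E.n) k → k)
    (hf : f ∈ glRegular k β.E.n) :
    ∃ f' ∈ glRegular k α.E.n, ∀ g : closureSubgroup α.kerMap,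
      f' g.1 = f (Diagram.closureMap h g).1 := by
  obtain ⟨f', hf', he⟩ := h.algebraic (restrictFun β.E.points f) ⟨f, hf, rfl⟩
  exact ⟨f', hf', fun g => congrFun he ⟨g.1, α.closure_le g.2⟩⟩

theorem Diagram.closureMap_algebraic {α β : Diagram S ρ} {φ : α.E.points →* β.E.points}
    (h : Diagram.IsHom α β φ) :
    IsAlgebraicHom (G := zariskiClosure α.kerMap) (H := zariskiClosure β.kerMap)
      (Diagram.closureMap h) := by
  intro f0 hf0
  obtain ⟨f, hf, hf0⟩ := LinAlgGroup.mem_regular.1 hf0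
  obtain ⟨f', hf', he⟩ := h.exists_glRegular f hf
  refine LinAlgGroup.mem_regular.2 ⟨f', hf', ?_⟩
  intro g
  have h1 := he g
  have h2 := hf0 (Diagram.closureMap h g)
  rw [h1]
  exact h2

/-- The same map, between the groups of the restricted diagrams. -/
def Diagram.resKerMap {α β : Diagram S ρ} {φ : α.E.points →* β.E.points}
    (h : Diagram.IsHom α β φ) : α.resKer.E.points →* β.resKer.E.points :=
  Diagram.closureMap h

theorem Diagram.resKerMap_lift {α β : Diagram S ρ} {φ : α.E.points →* β.E.points}
    (h : Diagram.IsHom α β φ) (t : ρ.ker) :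
    Diagram.resKerMap h (α.resKer.lift t) = β.resKer.lift t :=
  Subtype.ext (congrArg β.E.points.subtype (h.map_lift (t : Γ)))

theorem Diagram.resKerMap_isHom {α β : Diagram S ρ} {φ : α.E.points →* β.E.points}
    (h : Diagram.IsHom α β φ) : Diagram.IsHom α.resKer β.resKer (Diagram.resKerMap h) where
  algebraic := Diagram.closureMap_algebraic h
  map_lift t := Diagram.resKerMap_lift h t
  map_π _ := rfl

variable (S ρ)

/-- `Φ : 𝒯 → 𝒰`, from the unipotent completion of `T = ker ρ` to the prounipotent radical of the
completion of `Γ` relative to `ρ`, induced by `T → 𝒰`: its component in `E` is the projection of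
`𝒯` to the Zariski closure of the image of `T` in `E`, followed by the inclusion. -/
def Phi : unipotentCompletion k ρ.ker →* prounipotentRadical S ρ where
  toFun x := ⟨⟨fun α => Subgroup.inclusion α.closure_le (x.1 α.resKer), fun α β _ h =>
      Subtype.ext (congrArg (closureSubgroup β.kerMap).subtype
        (x.2 α.resKer β.resKer (Diagram.resKerMap h) (Diagram.resKerMap_isHom h)))⟩,
    fun α => α.closure_ker (x.1 α.resKer)⟩
  map_one' := rfl
  map_mul' _ _ := rfl

/-- `Φ` is compatible with the maps from `T` to `𝒯` and to `𝒰`. -/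
theorem Phi_toCompletion (t : ρ.ker) :
    ((Phi S ρ (toCompletion _ _ t) : prounipotentRadical S ρ) : completion S ρ) =
      toCompletion S ρ t := rfl

end Phi

/-! ### Cohomology -/

section Cohomology

variable {k : Type u} [Field k]

/-- Regular functions on `G × G`, i.e. `k[G] ⊗ k[G]`. -/
def LinAlgGroup.regular₂ (G : LinAlgGroup k) : Subalgebra k (G.points × G.points → k) :=
  Algebra.adjoin k ({c | ∃ f ∈ G.regular, c = fun p => f p.1} ∪
    {c | ∃ f ∈ G.regular, c = fun p => f p.2})

/-- Regular 2-cocycles of `G` with values in the trivial module `k`. -/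
def LinAlgGroup.cocycles₂ (G : LinAlgGroup k) : Submodule k (G.points × G.points → k) :=
  groupCohomology.cocycles₂ (Rep.trivial k G.points k) ⊓ Subalgebra.toSubmodule G.regular₂

/-- Coboundaries of regular 1-cochains. -/
def LinAlgGroup.coboundaries₂ (G : LinAlgGroup k) : Submodule k (G.points × G.points → k) :=
  (Subalgebra.toSubmodule G.regular).map
    (groupCohomology.d₁₂ (Rep.trivial k G.points k)).hom

/-- `H²(G, k)` for an algebraic group `G`: the (Hochschild) cohomology of the complex of regular
cochains, which classifies extensions of `G` by the additive group in the category of algebraic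
groups. If `k` is finite every cochain is regular and this is ordinary group cohomology. -/
abbrev LinAlgGroup.H2 (G : LinAlgGroup k) : Type u :=
  G.cocycles₂ ⧸ G.coboundaries₂.submoduleOf G.cocycles₂

/-- Pullback of functions of two variables. -/
def pull₂ (k : Type u) [Field k] {A B : Type u} (φ : A → B) : (B × B → k) →ₗ[k] (A × A → k) :=
  LinearMap.funLeft k k (Prod.map φ φ)

theorem pull₂_cocycle {A B : Type u} [Group A] [Group B] (φ : A →* B) {c : B × B → k}
    (hc : c ∈ groupCohomology.cocycles₂ (Rep.trivial k B k)) :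
    pull₂ k φ c ∈ groupCohomology.cocycles₂ (Rep.trivial k A k) := by
  have h := (groupCohomology.mem_cocycles₂_iff (A := Rep.trivial k B k) c).1 hc
  refine (groupCohomology.mem_cocycles₂_iff (A := Rep.trivial k A k) _).2 fun x y z => ?_
  have := h (φ x) (φ y) (φ z)
  rw [← map_mul, ← map_mul] at this
  exact this

theorem pull₂_coboundary {A B : Type u} [Group A] [Group B] (φ : A →* B) (f : B → k) :
    pull₂ k φ ((groupCohomology.d₁₂ (Rep.trivial k B k)).hom f) =
      (groupCohomology.d₁₂ (Rep.trivial k A k)).hom (fun a => f (φ a)) := by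
  funext p
  change f (φ p.2) - f (φ p.1 * φ p.2) + f (φ p.1) = f (φ p.2) - f (φ (p.1 * p.2)) + f (φ p.1)
  rw [map_mul]

theorem pull₂_regular {G H : LinAlgGroup k} {φ : G.points →* H.points} (hφ : IsAlgebraicHom φ)
    {c : H.points × H.points → k} (hc : c ∈ H.regular₂) : pull₂ k φ c ∈ G.regular₂ := by
  induction hc using Algebra.adjoin_induction with
  | mem c hc =>
    rcases hc with ⟨f, hf, rfl⟩ | ⟨f, hf, rfl⟩
    · exact Algebra.subset_adjoin (Or.inl ⟨_, hφ f hf, rfl⟩)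
    · exact Algebra.subset_adjoin (Or.inr ⟨_, hφ f hf, rfl⟩)
  | algebraMap r => exact G.regular₂.algebraMap_mem r
  | add f g _ _ h1 h2 => exact G.regular₂.add_mem h1 h2
  | mul f g _ _ h1 h2 => exact G.regular₂.mul_mem h1 h2

/-- The map on `H²` induced by an algebraic homomorphism. -/
def pullH2 {G H : LinAlgGroup k} (φ : G.points →* H.points) (hφ : IsAlgebraicHom φ) :
    H.H2 →ₗ[k] G.H2 :=
  Submodule.mapQ _ _
    ((pull₂ k φ).restrict (p := H.cocycles₂) (q := G.cocycles₂)
      fun _ hc => ⟨pull₂_cocycle φ hc.1, pull₂_regular hφ hc.2⟩) (by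
    rintro ⟨c, hc⟩ ⟨f, hf, hfc⟩
    refine ⟨fun g => f (φ g), hφ f hf, ?_⟩
    rw [← pull₂_coboundary φ f, hfc]
    rfl)

variable {Γ : Type u} [Group Γ]

/-- The restriction map `H²(G, k) → H²(Γ, k)` along a homomorphism from an abstract group `Γ` to
(the points of) the algebraic group `G`; the target is ordinary group cohomology. -/
def resH2 {G : LinAlgGroup k} (τ : Γ →* G.points) :
    G.H2 →ₗ[k] groupCohomology.H2 (Rep.trivial k Γ k) :=
  Submodule.liftQ _
    ((groupCohomology.H2π (Rep.trivial k Γ k)).hom ∘ₗ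
      (pull₂ k τ).restrict (p := G.cocycles₂)
        (q := groupCohomology.cocycles₂ (Rep.trivial k Γ k)) fun _ hc => pull₂_cocycle τ hc.1) (by
    rintro ⟨c, hc⟩ ⟨f, hf, hfc⟩
    refine (groupCohomology.H2π_eq_zero_iff _).2 ⟨fun γ => f (τ γ), ?_⟩
    rw [← pull₂_coboundary τ f, hfc]
    rfl)

theorem resH2_pullH2 {G H : LinAlgGroup k} (φ : G.points →* H.points) (hφ : IsAlgebraicHom φ)
    (τ : Γ →* G.points) (σ : Γ →* H.points) (h : ∀ γ, φ (τ γ) = σ γ) (x : H.H2) :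
    resH2 τ (pullH2 φ hφ x) = resH2 σ x := by
  obtain rfl : σ = φ.comp τ := MonoidHom.ext fun γ => (h γ).symm
  induction x using Submodule.Quotient.induction_on with
  | H c => rfl

variable (S : LinAlgGroup k) (ρ : Γ →* S.points)

/-- The transition maps `H²(E_α, k) → H²(E_β, k)` for `α ≤ β`. -/
def transH2 (α β : Diagram S ρ) (h : α ≤ β) : α.E.H2 →ₗ[k] β.E.H2 :=
  pullH2 h.choose h.choose_spec.algebraic

open Classical in
/-- The continuous cohomology `H²_cts(𝒢, k) = colim_α H²(E_α, k)` of the relative completion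
`𝒢 = lim_α E_α`. -/
abbrev H2cts : Type u :=
  Module.DirectLimit (fun α : Diagram S ρ => α.E.H2) (transH2 S ρ)

open Classical in
/-- The restriction map `H²_cts(𝒢, k) → H²(Γ, k)`. -/
def restriction : H2cts S ρ →ₗ[k] groupCohomology.H2 (Rep.trivial k Γ k) :=
  Module.DirectLimit.lift k (Diagram S ρ) (fun α => α.E.H2) (transH2 S ρ)
    (fun α => resH2 α.lift)
    (fun _ _ h x => resH2_pullH2 _ h.choose_spec.algebraic _ _ h.choose_spec.map_lift x)

end Cohomology

end RelComp

end

/-! A regular cocycle c on G_α defines a central extension of G_α by the additive group. If its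
class dies on Γ, the pulled-back extension splits, so Γ lifts to it. The Zariski closure of the
image of this lift is again an extension of S by a unipotent group, and c becomes a coboundary on
it. Hence the class is already zero in the colimit.

The proof runs this argument through algebras of functions on Γ. By density, a diagram is determined
by the algebra A of functions it induces on Γ, and inclusion of algebras gives the order on diagrams
(`Diagram.le_of_liftAlg_le`). The algebras that arise are characterised by `IsUnipotentHopf`:
finitely generated, stable under comultiplication and inversion, containing the functions that come
from S, and exhausted by the filtration `fil`. One direction is `Diagram.isUnipotentHopf`; the
other, `IsUnipotentHopf.exists_diagram`, uses a finite dimensional generating piece of the right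
regular representation and surjectivity of ρ.

Unipotence is expressed by ideals and not by points of the kernel, since over a small field the
kernel may have too few rational points to detect it.

If the pullback of c to Γ is the coboundary of a function f, then A[f] is again such an algebra
(`IsUnipotentHopf.adjoin_cochain`). On the resulting diagram f is regular and, by density, c is its
coboundary. Joins of algebras (`IsUnipotentHopf.sup`) make the system directed, so vanishing at a
later stage gives injectivity on the colimit. -/

noncomputable section

namespace RelComp

/-! ### Representative functions and the unipotent filtration -/

section Filtration

variable {k Γ : Type u} [Field k]

/-- The external product of functions, `(p, q) ↦ ((x, y) ↦ p x * q y)`. -/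
def boxBilin (k Γ : Type u) [Field k] : (Γ → k) →ₗ[k] (Γ → k) →ₗ[k] (Γ × Γ → k) :=
  LinearMap.mk₂ k (fun p q x => p x.1 * q x.2)
    (fun _ _ _ => funext fun _ => add_mul _ _ _) (fun _ _ _ => funext fun _ => mul_assoc _ _ _)
    (fun _ _ _ => funext fun _ => mul_add _ _ _)
    (fun _ _ _ => funext fun _ => mul_left_comm _ _ _)

/-- The span of the external products of elements of `P` and `Q`, i.e. `P ⊗ Q`. -/
def box (P Q : Submodule k (Γ → k)) : Submodule k (Γ × Γ → k) :=
  Submodule.map₂ (boxBilin k Γ) P Q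

theorem mul_mem_box {P Q : Submodule k (Γ → k)} {p q : Γ → k} (hp : p ∈ P) (hq : q ∈ Q) :
    (fun x : Γ × Γ => p x.1 * q x.2) ∈ box P Q :=
  Submodule.apply_mem_map₂ (boxBilin k Γ) hp hq

theorem box_mono {P P' Q Q' : Submodule k (Γ → k)} (hP : P ≤ P') (hQ : Q ≤ Q') :
    box P Q ≤ box P' Q' :=
  Submodule.map₂_le_map₂ hP hQ

theorem box_le {P Q : Submodule k (Γ → k)} {N : Submodule k (Γ × Γ → k)}
    (h : ∀ p ∈ P, ∀ q ∈ Q, (fun x : Γ × Γ => p x.1 * q x.2) ∈ N) : box P Q ≤ N :=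
  Submodule.map₂_le.2 h

theorem mul_box_mem {P Q P' Q' P'' Q'' : Submodule k (Γ → k)}
    (hP : ∀ p ∈ P, ∀ p' ∈ P', p * p' ∈ P'') (hQ : ∀ q ∈ Q, ∀ q' ∈ Q', q * q' ∈ Q'')
    {F G : Γ × Γ → k} (hF : F ∈ box P Q) (hG : G ∈ box P' Q') : F * G ∈ box P'' Q'' := by
  have h1 : box P Q ≤ (box P'' Q'').comap (LinearMap.mulRight k G) := by
    refine box_le fun p hp q hq => ?_
    have h2 : box P' Q' ≤ (box P'' Q'').comap
        (LinearMap.mulLeft k (fun x : Γ × Γ => p x.1 * q x.2)) := by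
      refine box_le fun p' hp' q' hq' => ?_
      have := mul_mem_box (hP p hp p' hp') (hQ q hq q' hq')
      refine Submodule.mem_comap.2 ?_
      convert this using 1
      funext x
      simp only [LinearMap.mulLeft_apply, Pi.mul_apply]
      ring
    exact h2 hG
  exact h1 hF

/-- Applying a linear form in the first variable to an element of `P ⊗ Q` gives one of `Q`. -/
theorem slice_mem {P Q : Submodule k (Γ → k)} {F : Γ × Γ → k} (hF : F ∈ box P Q)
    (l : Module.Dual k (Γ → k)) : (fun y => l fun x => F (x, y)) ∈ Q := by
  let L : (Γ × Γ → k) →ₗ[k] (Γ → k) :=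
    { toFun := fun F y => l fun x => F (x, y)
      map_add' := fun F G => funext fun y => l.map_add (fun x => F (x, y)) fun x => G (x, y)
      map_smul' := fun c F => funext fun y => l.map_smul c fun x => F (x, y) }
  refine (box_le (N := Q.comap L) fun p _ q hq => ?_) hF
  have : L (fun x : Γ × Γ => p x.1 * q x.2) = l p • q := by
    funext y
    have : (fun x => p x * q y) = q y • p := funext fun x => mul_comm _ _
    change l (fun x => p x * q y) = l p * q y
    rw [this, map_smul, smul_eq_mul, mul_comm]
  rw [Submodule.mem_comap, this]
  exact Q.smul_mem _ hq

theorem slice_eq_zero {P Q : Submodule k (Γ → k)} {F : Γ × Γ → k} (hF : F ∈ box P Q)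
    {l : Module.Dual k (Γ → k)} (hl : ∀ p ∈ P, l p = 0) (y : Γ) : l (fun x => F (x, y)) = 0 := by
  have h : box P Q ≤ (LinearMap.ker l).comap (LinearMap.funLeft k k fun x => (x, y)) := by
    refine box_le fun p hp q _ => ?_
    have : (fun x => p x * q y) = q y • p := funext fun x => mul_comm _ _
    change l (fun x => p x * q y) = 0
    rw [this, map_smul, hl p hp, smul_zero]
  exact h hF

/-- The slices of an element of `P ⊗ Q` lie in a finite dimensional subspace of `P`. -/
theorem exists_fg_slice {P Q : Submodule k (Γ → k)} {F : Γ × Γ → k} (hF : F ∈ box P Q) :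
    ∃ W ≤ P, W.FG ∧ ∀ y, (fun x => F (x, y)) ∈ W := by
  rw [box, Submodule.map₂_eq_span_image2] at hF
  induction hF using Submodule.span_induction with
  | mem F hF =>
    obtain ⟨p, hp, q, hq, rfl⟩ := hF
    refine ⟨k ∙ p, by simpa using hp, Submodule.fg_span_singleton p, fun y => ?_⟩
    exact Submodule.mem_span_singleton.2 ⟨q y, funext fun x => mul_comm _ _⟩
  | zero => exact ⟨⊥, bot_le, Submodule.fg_bot, fun _ => Submodule.zero_mem _⟩
  | smul c F _ hF =>
    obtain ⟨W, hW, hfg, h⟩ := hF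
    exact ⟨W, hW, hfg, fun y => W.smul_mem c (h y)⟩
  | add F G _ _ hF hG =>
    obtain ⟨W, hW, hfg, h⟩ := hF
    obtain ⟨W', hW', hfg', h'⟩ := hG
    exact ⟨W ⊔ W', sup_le hW hW', hfg.sup hfg', fun y =>
      Submodule.add_mem_sup (h y) (h' y)⟩

/-- Pullback along the first projection. -/
def fstPull (k Γ : Type u) [Field k] : (Γ → k) →ₐ[k] (Γ × Γ → k) :=
  AlgHom.pi fun x => Pi.evalAlgHom k _ x.1

variable [Group Γ]

/-- The comultiplication `a ↦ ((x, y) ↦ a (x * y))`. -/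
def comul (k Γ : Type u) [Field k] [Group Γ] : (Γ → k) →ₐ[k] (Γ × Γ → k) :=
  AlgHom.pi fun x => Pi.evalAlgHom k _ (x.1 * x.2)

/-- The map `a ↦ ((x, y) ↦ a (x * y) - a x)`. -/
def diff (k Γ : Type u) [Field k] [Group Γ] : (Γ → k) →ₗ[k] (Γ × Γ → k) :=
  (comul k Γ).toLinearMap - (fstPull k Γ).toLinearMap

theorem diff_apply (a : Γ → k) (x y : Γ) : diff k Γ a (x, y) = a (x * y) - a x := rfl

/-- The filtration of an algebra of functions by the order of unipotency with respect to the
subgroup cut out by `J`. -/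
def fil (A : Subalgebra k (Γ → k)) (J : Submodule k (Γ → k)) : ℕ → Submodule k (Γ → k)
  | 0 => ⊥
  -- The summand A ⊗ J discards what vanishes for y in the subgroup cut out by J. Modulo it, right
  -- translation by that subgroup changes a only by elements of level i; level 1 thus consists of
  -- the invariants.
  | i + 1 => Subalgebra.toSubmodule A ⊓
      (box (fil A J i) (Subalgebra.toSubmodule A) ⊔ box (Subalgebra.toSubmodule A) J).comap
        (diff k Γ)

variable {A A' : Subalgebra k (Γ → k)} {J J' : Submodule k (Γ → k)}

theorem fil_le (A : Subalgebra k (Γ → k)) (J : Submodule k (Γ → k)) :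
    ∀ i, fil A J i ≤ Subalgebra.toSubmodule A
  | 0 => bot_le
  | _ + 1 => inf_le_left

theorem fil_le_succ (A : Subalgebra k (Γ → k)) (J : Submodule k (Γ → k)) :
    ∀ i, fil A J i ≤ fil A J (i + 1)
  | 0 => bot_le
  | i + 1 => inf_le_inf_left _ (Submodule.comap_mono
      (sup_le_sup_right (box_mono (fil_le_succ A J i) le_rfl) _))

theorem fil_mono (A : Subalgebra k (Γ → k)) (J : Submodule k (Γ → k)) : Monotone (fil A J) :=
  monotone_nat_of_le_succ (fil_le_succ A J)

theorem fil_mono_left (hA : A ≤ A') (hJ : J ≤ J') : ∀ i, fil A J i ≤ fil A' J' i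
  | 0 => le_rfl
  | i + 1 => inf_le_inf hA (Submodule.comap_mono
      (sup_le_sup (box_mono (fil_mono_left hA hJ i) hA) (box_mono hA hJ)))

theorem mem_fil_succ {a : Γ → k} {i : ℕ} : a ∈ fil A J (i + 1) ↔ a ∈ A ∧
    diff k Γ a ∈ box (fil A J i) (Subalgebra.toSubmodule A) ⊔ box (Subalgebra.toSubmodule A) J :=
  Iff.rfl

theorem one_mem_fil : (1 : Γ → k) ∈ fil A J 1 := by
  refine mem_fil_succ.2 ⟨A.one_mem, ?_⟩
  have : diff k Γ 1 = 0 := by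
    funext x
    exact sub_self _
  rw [this]
  exact Submodule.zero_mem _

/-- Thanks to this, finite order of unipotency need only be checked on algebra generators. The
induction rests on a Leibniz rule for `diff` with a quadratic correction term. -/
theorem fil_mul_mem (hJ : ∀ a ∈ A, ∀ f ∈ J, a * f ∈ J) (hJA : J ≤ Subalgebra.toSubmodule A)
    (i j : ℕ) {a b : Γ → k} (ha : a ∈ fil A J i) (hb : b ∈ fil A J j) :
    a * b ∈ fil A J (i + j) := by
  induction i generalizing j a b with
  | zero =>
    rw [show a = 0 from ha, zero_mul]
    exact Submodule.zero_mem _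
  | succ i ihi =>
    induction j generalizing a b with
    | zero =>
      rw [show b = 0 from hb, mul_zero]
      exact Submodule.zero_mem _
    | succ j ihj =>
      obtain ⟨haA, hda⟩ := mem_fil_succ.1 ha
      obtain ⟨hbA, hdb⟩ := mem_fil_succ.1 hb
      refine mem_fil_succ.2 ⟨A.mul_mem haA hbA, ?_⟩
      have one_box : ∀ {c : Γ → k} {P : Submodule k (Γ → k)}, c ∈ P →
          fstPull k Γ c ∈ box P (Subalgebra.toSubmodule A) := by
        intro c P hc
        convert mul_mem_box hc ((Subalgebra.mem_toSubmodule A).2 A.one_mem) using 1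
        funext x
        exact (mul_one (c x.1)).symm
      have e : diff k Γ (a * b) = fstPull k Γ a * diff k Γ b + diff k Γ a * fstPull k Γ b +
          diff k Γ a * diff k Γ b := by
        funext ⟨x, y⟩
        change a (x * y) * b (x * y) - a x * b x = a x * (b (x * y) - b x) +
          (a (x * y) - a x) * b x + (a (x * y) - a x) * (b (x * y) - b x)
        ring
      have AA : ∀ p ∈ Subalgebra.toSubmodule A, ∀ q ∈ Subalgebra.toSubmodule A,
          p * q ∈ Subalgebra.toSubmodule A := fun p hp q hq => A.mul_mem hp hq
      have JA : ∀ p ∈ J, ∀ q ∈ Subalgebra.toSubmodule A, p * q ∈ J := fun p hp q hq => by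
        rw [mul_comm]
        exact hJ q hq p hp
      have AJ : ∀ p ∈ Subalgebra.toSubmodule A, ∀ q ∈ J, p * q ∈ J := hJ
      obtain ⟨a1, ha1, a2, ha2, hea⟩ := Submodule.mem_sup.1 hda
      obtain ⟨b1, hb1, b2, hb2, heb⟩ := Submodule.mem_sup.1 hdb
      have hij : i + 1 + j = i + (j + 1) := by omega
      rw [e, ← hea, ← heb, mul_add, add_mul, add_mul, mul_add, mul_add]
      have l {x} (h : x ∈ box (fil A J (i + 1 + j)) (Subalgebra.toSubmodule A)) :=
        Submodule.mem_sup_left (T := box (Subalgebra.toSubmodule A) J) h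
      have r {x} (h : x ∈ box (Subalgebra.toSubmodule A) J) :=
        Submodule.mem_sup_right (S := box (fil A J (i + 1 + j)) (Subalgebra.toSubmodule A)) h
      -- Each product with a factor from A ⊗ J stays there because J is an ideal. In the three
      -- others one factor has dropped a level, so an induction hypothesis applies.
      refine add_mem (add_mem (add_mem (l ?_) (r ?_)) (add_mem (l ?_) (r ?_)))
        (add_mem (add_mem (l ?_) (r ?_)) (add_mem (r ?_) (r ?_)))
      · exact mul_box_mem (fun p hp q hq => ihj hp hq) AA (one_box ha) hb1
      · exact mul_box_mem AA AJ (one_box ((Subalgebra.mem_toSubmodule A).2 haA)) hb2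
      · rw [hij]
        exact mul_box_mem (fun p hp q hq => ihi _ hp hq) AA ha1 (one_box hb)
      · exact mul_box_mem AA JA ha2 (one_box ((Subalgebra.mem_toSubmodule A).2 hbA))
      · rw [hij]
        exact mul_box_mem (fun p hp q hq => ihi _ hp (fil_le_succ A J j hq)) AA ha1 hb1
      · exact mul_box_mem (fun p hp q hq => A.mul_mem (fil_le A J i hp) hq) AJ ha1 hb2
      · exact mul_box_mem (fun p hp q hq => A.mul_mem hp (fil_le A J j hq)) JA ha2 hb1
      · exact mul_box_mem AA (fun p hp q hq => hJ p (hJA hp) q hq) ha2 hb2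

/-- The functions of `A` of finite order of unipotency. -/
def filUnion (hJ : ∀ a ∈ A, ∀ f ∈ J, a * f ∈ J) (hJA : J ≤ Subalgebra.toSubmodule A) :
    Subalgebra k (Γ → k) where
  carrier := {a | ∃ i, a ∈ fil A J i}
  mul_mem' := fun ⟨i, hi⟩ ⟨j, hj⟩ => ⟨i + j, fil_mul_mem hJ hJA i j hi hj⟩
  add_mem' := fun ⟨i, hi⟩ ⟨j, hj⟩ => ⟨max i j, add_mem (fil_mono A J (le_max_left i j) hi)
    (fil_mono A J (le_max_right i j) hj)⟩
  algebraMap_mem' r := ⟨1, by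
    rw [Algebra.algebraMap_eq_smul_one]
    exact Submodule.smul_mem _ r one_mem_fil⟩

end Filtration

/-! ### Coordinate algebras and extension of homomorphisms by density -/

section Coord

variable {k Γ : Type u} [Field k]

/-- Pullback of functions as an algebra homomorphism. -/
def pullAlg (k : Type u) [Field k] {X : Type u} (τ : Γ → X) : (X → k) →ₐ[k] (Γ → k) :=
  AlgHom.pi fun γ => Pi.evalAlgHom k _ (τ γ)

variable [Group Γ] {n : ℕ}

/-- The algebra of functions on `Γ` which are pulled back from `GL_n` along `τ`. -/
def coordAlg (τ : Γ →* Matrix.GeneralLinearGroup (Fin n) k) : Subalgebra k (Γ → k) :=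
  (glRegular k n).map (pullAlg k τ)

theorem entry_mem_glRegular (i j : Fin n) :
    (fun g : Matrix.GeneralLinearGroup (Fin n) k => (g : Matrix (Fin n) (Fin n) k) i j) ∈
      glRegular k n :=
  Algebra.subset_adjoin (Or.inl ⟨i, j, rfl⟩)

theorem inv_entry_mem_glRegular (i j : Fin n) :
    (fun g : Matrix.GeneralLinearGroup (Fin n) k =>
      ((g⁻¹ : Matrix.GeneralLinearGroup (Fin n) k) : Matrix (Fin n) (Fin n) k) i j) ∈
      glRegular k n :=
  Algebra.subset_adjoin (Or.inr ⟨i, j, rfl⟩)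

theorem glRegular_fg : (glRegular k n).FG := by
  refine Subalgebra.fg_def.2 ⟨_, Set.Finite.union ?_ ?_, rfl⟩
  · refine (Set.finite_range fun (p : Fin n × Fin n) =>
      fun g : Matrix.GeneralLinearGroup (Fin n) k =>
        (g : Matrix (Fin n) (Fin n) k) p.1 p.2).subset ?_
    rintro f ⟨i, j, rfl⟩
    exact ⟨(i, j), rfl⟩
  · refine (Set.finite_range fun (p : Fin n × Fin n) =>
      fun g : Matrix.GeneralLinearGroup (Fin n) k =>
        ((g⁻¹ : Matrix.GeneralLinearGroup (Fin n) k) : Matrix (Fin n) (Fin n) k) p.1 p.2).subset ?_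
    rintro f ⟨i, j, rfl⟩
    exact ⟨(i, j), rfl⟩

variable (τ : Γ →* Matrix.GeneralLinearGroup (Fin n) k)

theorem coordAlg_fg : (coordAlg τ).FG := glRegular_fg.map _

theorem entry_mem_coordAlg (i j : Fin n) :
    (fun γ => (τ γ : Matrix (Fin n) (Fin n) k) i j) ∈ coordAlg τ :=
  ⟨_, entry_mem_glRegular i j, rfl⟩

theorem inv_entry_mem_coordAlg (i j : Fin n) :
    (fun γ => (τ γ⁻¹ : Matrix (Fin n) (Fin n) k) i j) ∈ coordAlg τ :=
  ⟨_, inv_entry_mem_glRegular i j, by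
    funext γ
    rw [map_inv]
    rfl⟩

variable {τ}

theorem coordAlg_le {A : Subalgebra k (Γ → k)}
    (h : ∀ i j, (fun γ => (τ γ : Matrix (Fin n) (Fin n) k) i j) ∈ A)
    (h' : ∀ i j, (fun γ => (τ γ⁻¹ : Matrix (Fin n) (Fin n) k) i j) ∈ A) : coordAlg τ ≤ A := by
  rw [coordAlg, glRegular, AlgHom.map_adjoin, Algebra.adjoin_le_iff]
  rintro _ ⟨_, ⟨i, j, rfl⟩ | ⟨i, j, rfl⟩, rfl⟩
  · exact h i j
  · have e : (fun γ => (τ γ⁻¹ : Matrix (Fin n) (Fin n) k) i j) =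
        fun γ => ((τ γ)⁻¹ : Matrix.GeneralLinearGroup (Fin n) k).1 i j := by
      funext γ
      rw [map_inv]
    have := h' i j
    rw [e] at this
    exact this

/-- Every `k`-point of the algebra `k[GL_n]` is given by evaluation at an element of `GL_n(k)`. -/
theorem exists_point (χ : glRegular k n →ₐ[k] k) :
    ∃ g : Matrix.GeneralLinearGroup (Fin n) k, ∀ f : glRegular k n,
      χ f = (f : Matrix.GeneralLinearGroup (Fin n) k → k) g := by
  let x (i j : Fin n) : glRegular k n := ⟨_, entry_mem_glRegular i j⟩
  let y (i j : Fin n) : glRegular k n := ⟨_, inv_entry_mem_glRegular i j⟩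
  -- The relations XY = YX = 1 between the generators are carried by χ to a pair of mutually inverse
  -- matrices over k.
  have hxy (i j : Fin n) : ∑ l, x i l * y l j = algebraMap k _ ((1 : Matrix _ _ k) i j) := by
    apply Subtype.ext
    funext g
    have := congrFun (congrFun (Units.mul_inv g) i) j
    rw [Matrix.mul_apply] at this
    simpa [x, y, Finset.sum_apply] using this
  have hyx (i j : Fin n) : ∑ l, y i l * x l j = algebraMap k _ ((1 : Matrix _ _ k) i j) := by
    apply Subtype.ext
    funext g
    have := congrFun (congrFun (Units.inv_mul g) i) j
    rw [Matrix.mul_apply] at this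
    simpa [x, y, Finset.sum_apply] using this
  refine ⟨⟨Matrix.of fun i j => χ (x i j), Matrix.of fun i j => χ (y i j), ?_, ?_⟩, ?_⟩
  · ext i j
    have := congrArg χ (hxy i j)
    rw [map_sum, AlgHom.commutes] at this
    simpa [Matrix.mul_apply] using this
  · ext i j
    have := congrArg χ (hyx i j)
    rw [map_sum, AlgHom.commutes] at this
    simpa [Matrix.mul_apply] using this
  · rintro ⟨f, hf⟩
    induction hf using Algebra.adjoin_induction with
    | mem f hf => rcases hf with ⟨i, j, rfl⟩ | ⟨i, j, rfl⟩ <;> rfl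
    | algebraMap r => exact χ.commutes r
    | add f g hf hg h1 h2 =>
      exact (χ.map_add ⟨f, hf⟩ ⟨g, hg⟩).trans (congrArg₂ (· + ·) h1 h2)
    | mul f g hf hg h1 h2 =>
      exact (χ.map_mul ⟨f, hf⟩ ⟨g, hg⟩).trans (congrArg₂ (· * ·) h1 h2)

end Coord

section Extension

variable {k Γ : Type u} [Field k] [Group Γ] {G H : LinAlgGroup k}

/-- The algebra of functions on `Γ` which are pulled back from regular functions on `G`. -/
abbrev liftAlg (lift : Γ →* G.points) : Subalgebra k (Γ → k) :=
  coordAlg (G.points.subtype.comp lift)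

theorem mem_liftAlg {lift : Γ →* G.points} {f : Γ → k} :
    f ∈ liftAlg lift ↔ ∃ F ∈ G.regular, ∀ γ, F (lift γ) = f γ :=
  ⟨fun ⟨F, hF, h⟩ => ⟨restrictFun _ F, ⟨F, hF, rfl⟩, fun γ => congrFun h γ⟩,
    fun ⟨_, ⟨F, hF, e⟩, h⟩ => ⟨F, hF, funext fun γ => (congrFun e (lift γ)).trans (h γ)⟩⟩

theorem LinAlgGroup.restrict_mem (G : LinAlgGroup k)
    {f : Matrix.GeneralLinearGroup (Fin G.n) k → k} (hf : f ∈ glRegular k G.n) :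
    (fun g : G.points => f g) ∈ G.regular :=
  ⟨f, hf, rfl⟩

theorem LinAlgGroup.mul_right_mem {f : G.points → k} (hf : f ∈ G.regular) (h : G.points) :
    (fun g => f (g * h)) ∈ G.regular := by
  obtain ⟨F, hF, rfl⟩ := hf
  exact ⟨_, glRegular_mul_right hF h, rfl⟩

theorem LinAlgGroup.mul_left_mem {f : G.points → k} (hf : f ∈ G.regular) (h : G.points) :
    (fun g => f (h * g)) ∈ G.regular := by
  obtain ⟨F, hF, rfl⟩ := hf
  exact ⟨_, glRegular_mul_left hF h, rfl⟩

theorem LinAlgGroup.points_ext {g h : G.points} (e : ∀ f ∈ G.regular, f g = f h) : g = h :=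
  Subtype.ext (Units.ext (Matrix.ext fun i j =>
    e _ (G.restrict_mem (entry_mem_glRegular i j))))

theorem HasDenseImage.eq {lift : Γ →* G.points} (hd : HasDenseImage lift) {f f' : G.points → k}
    (hf : f ∈ G.regular) (hf' : f' ∈ G.regular) (h : ∀ γ, f (lift γ) = f' (lift γ)) : f = f' :=
  sub_eq_zero.1 (hd _ (G.regular.sub_mem hf hf') fun γ => sub_eq_zero.2 (h γ))

theorem HasDenseImage.hom_ext {lift : Γ →* G.points} (hd : HasDenseImage lift)
    {φ ψ : G.points →* H.points} (hφ : IsAlgebraicHom φ) (hψ : IsAlgebraicHom ψ)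
    (h : ∀ γ, φ (lift γ) = ψ (lift γ)) (g : G.points) : φ g = ψ g :=
  LinAlgGroup.points_ext fun f hf =>
    congrFun (hd.eq (hφ f hf) (hψ f hf) fun γ => congrArg f (h γ)) g

/-- A homomorphism from `Γ` to `H` extends to an algebraic homomorphism on `G`, if `Γ` is dense
in `G` and the regular functions on `H` extend to `G`. -/
theorem HasDenseImage.exists_extension {lift : Γ →* G.points} (hd : HasDenseImage lift)
    (p : Γ →* H.points) (hp : liftAlg p ≤ liftAlg lift) :
    ∃ φ : G.points →* H.points, IsAlgebraicHom φ ∧ ∀ γ, φ (lift γ) = p γ := by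
  have hθ : ∀ f : glRegular k H.n, ∃ F : G.regular, ∀ γ,
      (F : G.points → k) (lift γ) = (f : Matrix.GeneralLinearGroup (Fin H.n) k → k) (p γ) := by
    intro f
    obtain ⟨F, hF, h⟩ := mem_liftAlg.1 (hp ⟨f.1, f.2, rfl⟩)
    exact ⟨⟨F, hF⟩, h⟩
  choose θ hθ using hθ
  have uniq {F F' : G.regular} (h : ∀ γ, (F : G.points → k) (lift γ) =
      (F' : G.points → k) (lift γ)) : F = F' := Subtype.ext (hd.eq F.2 F'.2 h)
  -- Density makes the extension from Γ to G unique, so the chosen extensions respect the algebra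
  -- structure.
  let Θ : glRegular k H.n →ₐ[k] G.regular :=
    { toFun := θ
      map_one' := uniq fun γ => hθ 1 γ
      map_zero' := uniq fun γ => hθ 0 γ
      map_mul' := fun a b => uniq fun γ => (hθ (a * b) γ).trans
        (congrArg₂ (· * ·) (hθ a γ).symm (hθ b γ).symm)
      map_add' := fun a b => uniq fun γ => (hθ (a + b) γ).trans
        (congrArg₂ (· + ·) (hθ a γ).symm (hθ b γ).symm)
      commutes' := fun r => uniq fun γ => hθ (algebraMap _ _ r) γ }
  -- Evaluation at g after Θ is a k-point of k[GL_n], hence a matrix. It satisfies the equations of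
  -- H, because these pull back to 0 on Γ and so to 0 on G.
  have hq : ∀ g : G.points, ∃ q : H.points, ∀ f : glRegular k H.n,
      (f : Matrix.GeneralLinearGroup (Fin H.n) k → k) q = (θ f : G.points → k) g := by
    intro g
    obtain ⟨q, hq⟩ := exists_point
      (((Pi.evalAlgHom k (fun _ : G.points => k) g).comp G.regular.val).comp Θ)
    obtain ⟨I, hI, hH⟩ := H.isClosed
    refine ⟨⟨q, (hH q).2 fun f hf => ?_⟩, fun f => (hq f).symm⟩
    refine (hq ⟨f, hI hf⟩).symm.trans ?_
    have : θ ⟨f, hI hf⟩ = 0 := uniq fun γ => by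
      rw [hθ]
      exact (hH _).1 (p γ).2 f hf
    change (θ ⟨f, hI hf⟩ : G.points → k) g = 0
    rw [this]
    rfl
  choose q hq using hq
  have hreg : ∀ f ∈ H.regular, (fun g => f (q g)) ∈ G.regular := by
    rintro _ ⟨f, hf, rfl⟩
    have : (θ ⟨f, hf⟩ : G.points → k) = fun g => f (q g) :=
      funext fun g => (hq g ⟨f, hf⟩).symm
    exact this ▸ (θ ⟨f, hf⟩).2
  have hqp : ∀ γ, q (lift γ) = p γ := fun γ => LinAlgGroup.points_ext fun f hf => by
    obtain ⟨f, hf, rfl⟩ := hf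
    exact (hq _ ⟨f, hf⟩).trans (hθ ⟨f, hf⟩ γ)
  -- Multiplicativity is extended by density one variable at a time, the left factor staying in Γ at
  -- first.
  have hmul_lift : ∀ γ h, q (lift γ * h) = q (lift γ) * q h := fun γ h =>
    LinAlgGroup.points_ext fun f hf => by
      refine congrFun (hd.eq (LinAlgGroup.mul_left_mem (hreg f hf) (lift γ))
        (hreg _ (LinAlgGroup.mul_left_mem hf (q (lift γ)))) fun δ => ?_) h
      rw [← map_mul, hqp, hqp, hqp, map_mul]
  have hmul : ∀ g h, q (g * h) = q g * q h := fun g h => LinAlgGroup.points_ext fun f hf =>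
    congrFun (hd.eq (LinAlgGroup.mul_right_mem (hreg f hf) h)
      (hreg _ (LinAlgGroup.mul_right_mem hf (q h))) fun γ => congrArg f (hmul_lift γ h)) g
  exact ⟨MonoidHom.mk' q hmul, hreg, hqp⟩

variable {S : LinAlgGroup k} {ρ : Γ →* S.points}

/-- Diagrams are ordered by their algebras of functions on `Γ`. -/
theorem Diagram.le_of_liftAlg_le {α β : Diagram S ρ} (h : liftAlg α.lift ≤ liftAlg β.lift) :
    α ≤ β := by
  obtain ⟨φ, hφ, hl⟩ := β.dense.exists_extension α.lift h
  refine ⟨φ, hφ, hl, fun x => ?_⟩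
  refine β.dense.hom_ext (φ := α.π.comp φ) (fun f hf => hφ _ (α.algebraic f hf)) β.algebraic
    (fun γ => ?_) x
  change α.π (φ (β.lift γ)) = β.π (β.lift γ)
  rw [hl, α.comm, β.comm]

end Extension

/-! ### Algebras of functions on `Γ` defining unipotent extensions of `S` -/

section Hopf

variable {k Γ : Type u} [Field k]

/-- The subalgebra `A ⊗ A` of functions on `Γ × Γ`. -/
def boxAlg (A : Subalgebra k (Γ → k)) : Subalgebra k (Γ × Γ → k) where
  carrier := box (Subalgebra.toSubmodule A) (Subalgebra.toSubmodule A)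
  mul_mem' := mul_box_mem (fun _ hp _ hq => A.mul_mem hp hq) fun _ hp _ hq => A.mul_mem hp hq
  add_mem' := add_mem
  algebraMap_mem' r := by
    have e : algebraMap k (Γ × Γ → k) r =
        fun x => algebraMap k (Γ → k) r x.1 * (1 : Γ → k) x.2 :=
      funext fun x => (mul_one r).symm
    rw [e]
    exact mul_mem_box (P := Subalgebra.toSubmodule A) (Q := Subalgebra.toSubmodule A)
      (A.algebraMap_mem r) A.one_mem

theorem mul_mem_boxAlg {A : Subalgebra k (Γ → k)} {p q : Γ → k} (hp : p ∈ A) (hq : q ∈ A) :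
    (fun x : Γ × Γ => p x.1 * q x.2) ∈ boxAlg A :=
  mul_mem_box (P := Subalgebra.toSubmodule A) (Q := Subalgebra.toSubmodule A) hp hq

theorem boxAlg_mono {A B : Subalgebra k (Γ → k)} (h : A ≤ B) : boxAlg A ≤ boxAlg B :=
  box_mono (P := Subalgebra.toSubmodule A) (Q := Subalgebra.toSubmodule A) h h

variable [Group Γ]

/-- Pullback along the inversion. -/
def invPull (k Γ : Type u) [Field k] [Group Γ] : (Γ → k) →ₐ[k] (Γ → k) :=
  pullAlg k fun γ : Γ => γ⁻¹

variable {S : LinAlgGroup k} (ρ : Γ →* S.points)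

/-- The ideal of `A` which cuts out the kernel of `ρ`. -/
def kerSpan (A : Subalgebra k (Γ → k)) : Submodule k (Γ → k) :=
  Submodule.span k {f | ∃ a ∈ A, ∃ h ∈ S.regular, h 1 = 0 ∧ f = fun γ => a γ * h (ρ γ)}

variable {ρ}

theorem kerSpan_le {A : Subalgebra k (Γ → k)} {N : Submodule k (Γ → k)}
    (H : ∀ a ∈ A, ∀ h ∈ S.regular, h 1 = 0 → (fun γ => a γ * h (ρ γ)) ∈ N) :
    kerSpan ρ A ≤ N := by
  refine Submodule.span_le.2 ?_
  rintro _ ⟨a, ha, h, hh, h1, rfl⟩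
  exact H a ha h hh h1

theorem mem_kerSpan {A : Subalgebra k (Γ → k)} {a : Γ → k} (ha : a ∈ A) {h : S.points → k}
    (hh : h ∈ S.regular) (h1 : h 1 = 0) : (fun γ => a γ * h (ρ γ)) ∈ kerSpan ρ A :=
  Submodule.subset_span ⟨a, ha, h, hh, h1, rfl⟩

theorem kerSpan_mono {A B : Subalgebra k (Γ → k)} (hAB : A ≤ B) : kerSpan ρ A ≤ kerSpan ρ B :=
  kerSpan_le fun _ ha _ hh h1 => mem_kerSpan (hAB ha) hh h1

theorem mul_mem_kerSpan {A : Subalgebra k (Γ → k)} (a : Γ → k) (ha : a ∈ A) (f : Γ → k)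
    (hf : f ∈ kerSpan ρ A) : a * f ∈ kerSpan ρ A := by
  refine (kerSpan_le (N := (kerSpan ρ A).comap (LinearMap.mulLeft k a))
    fun b hb h hh h1 => ?_) hf
  have e : a * (fun γ => b γ * h (ρ γ)) = fun γ => (a * b) γ * h (ρ γ) :=
    funext fun γ => (mul_assoc _ _ _).symm
  rw [Submodule.mem_comap, LinearMap.mulLeft_apply, e]
  exact mem_kerSpan (A.mul_mem ha hb) hh h1

theorem LinAlgGroup.inv_mem {G : LinAlgGroup k} {f : G.points → k} (hf : f ∈ G.regular) :
    (fun g => f g⁻¹) ∈ G.regular := by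
  obtain ⟨F, hF, rfl⟩ := hf
  exact ⟨_, glRegular_inv hF, rfl⟩

theorem invPull_mem_kerSpan {A : Subalgebra k (Γ → k)} (hA : ∀ a ∈ A, invPull k Γ a ∈ A)
    {f : Γ → k} (hf : f ∈ kerSpan ρ A) : invPull k Γ f ∈ kerSpan ρ A := by
  refine (kerSpan_le (N := (kerSpan ρ A).comap (invPull k Γ).toLinearMap)
    fun b hb h hh h1 => ?_) hf
  have e : invPull k Γ (fun γ => b γ * h (ρ γ)) =
      fun γ => invPull k Γ b γ * (fun g => h g⁻¹) (ρ γ) := by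
    funext γ
    change b γ⁻¹ * h (ρ γ⁻¹) = b γ⁻¹ * h (ρ γ)⁻¹
    rw [map_inv]
  rw [Submodule.mem_comap, AlgHom.toLinearMap_apply, e]
  exact mem_kerSpan (hA b hb) (LinAlgGroup.inv_mem hh) (by simpa using h1)

variable (ρ) in
/-- The properties of the algebra of functions on `Γ` defined by a diagram. -/
structure IsUnipotentHopf (A : Subalgebra k (Γ → k)) : Prop where
  fg : A.FG
  comul_mem : ∀ a ∈ A, comul k Γ a ∈ boxAlg A
  inv_mem : ∀ a ∈ A, invPull k Γ a ∈ A
  base : liftAlg ρ ≤ A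
  unip : ∀ a ∈ A, ∃ i, a ∈ fil A (kerSpan ρ A) i

theorem kerSpan_le_self {A : Subalgebra k (Γ → k)} (hA : liftAlg ρ ≤ A) :
    kerSpan ρ A ≤ Subalgebra.toSubmodule A :=
  kerSpan_le fun _ ha _ hh _ => A.mul_mem ha (hA (mem_liftAlg.2 ⟨_, hh, fun _ => rfl⟩))

/-- An algebra generated by functions satisfying the required properties has these properties. -/
theorem IsUnipotentHopf.of_adjoin {A : Subalgebra k (Γ → k)} (s : Set (Γ → k)) (hfg : A.FG)
    (hs : A ≤ Algebra.adjoin k s)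
    (comul_mem : ∀ a ∈ s, comul k Γ a ∈ boxAlg A) (inv_mem : ∀ a ∈ s, invPull k Γ a ∈ A)
    (base : liftAlg ρ ≤ A) (unip : ∀ a ∈ s, ∃ i, a ∈ fil A (kerSpan ρ A) i) :
    IsUnipotentHopf ρ A where
  fg := hfg
  comul_mem := hs.trans (Algebra.adjoin_le (S := (boxAlg A).comap (comul k Γ)) comul_mem)
  inv_mem := hs.trans (Algebra.adjoin_le (S := A.comap (invPull k Γ)) inv_mem)
  base := base
  unip := hs.trans (Algebra.adjoin_le
    (S := filUnion (A := A) (J := kerSpan ρ A) mul_mem_kerSpan (kerSpan_le_self base)) unip)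

/-- On the side of groups, this is the closure of Γ in the fibre product over S of two extensions.
-/
theorem IsUnipotentHopf.sup {A B : Subalgebra k (Γ → k)} (hA : IsUnipotentHopf ρ A)
    (hB : IsUnipotentHopf ρ B) : IsUnipotentHopf ρ (A ⊔ B) := by
  refine .of_adjoin (A ∪ B) (hA.fg.sup hB.fg) (sup_le ?_ ?_) ?_ ?_ (hA.base.trans le_sup_left) ?_
  · exact fun a ha => Algebra.subset_adjoin (Or.inl ha)
  · exact fun a ha => Algebra.subset_adjoin (Or.inr ha)
  · rintro a (ha | ha)
    · exact boxAlg_mono le_sup_left (hA.comul_mem a ha)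
    · exact boxAlg_mono le_sup_right (hB.comul_mem a ha)
  · rintro a (ha | ha)
    · exact (le_sup_left : A ≤ A ⊔ B) (hA.inv_mem a ha)
    · exact (le_sup_right : B ≤ A ⊔ B) (hB.inv_mem a ha)
  · rintro a (ha | ha)
    · obtain ⟨i, hi⟩ := hA.unip a ha
      exact ⟨i, fil_mono_left le_sup_left (kerSpan_mono le_sup_left) i hi⟩
    · obtain ⟨i, hi⟩ := hB.unip a ha
      exact ⟨i, fil_mono_left le_sup_right (kerSpan_mono le_sup_right) i hi⟩

/-- Every element of `A ⊗ A` lies in some `fil i ⊗ A`. -/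
theorem IsUnipotentHopf.exists_mem_box {A : Subalgebra k (Γ → k)} (hA : IsUnipotentHopf ρ A)
    {F : Γ × Γ → k} (hF : F ∈ boxAlg A) :
    ∃ i, F ∈ box (fil A (kerSpan ρ A) i) (Subalgebra.toSubmodule A) := by
  replace hF : F ∈ box (Subalgebra.toSubmodule A) (Subalgebra.toSubmodule A) := hF
  rw [box, Submodule.map₂_eq_span_image2] at hF
  induction hF using Submodule.span_induction with
  | mem F hF =>
    obtain ⟨p, hp, q, hq, rfl⟩ := hF
    obtain ⟨i, hi⟩ := hA.unip p hp
    exact ⟨i, mul_mem_box hi hq⟩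
  | zero => exact ⟨0, Submodule.zero_mem _⟩
  | smul c F _ hF => exact hF.imp fun i hi => Submodule.smul_mem _ c hi
  | add F G _ _ hF hG =>
    obtain ⟨i, hi⟩ := hF
    obtain ⟨j, hj⟩ := hG
    exact ⟨max i j, add_mem (box_mono (fil_mono _ _ (le_max_left i j)) le_rfl hi)
      (box_mono (fil_mono _ _ (le_max_right i j)) le_rfl hj)⟩

/-- Adjoining a function whose coboundary lies in `A ⊗ A`. -/
theorem IsUnipotentHopf.adjoin_cochain {A : Subalgebra k (Γ → k)} (hA : IsUnipotentHopf ρ A)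
    {f : Γ → k} {c : Γ × Γ → k} (hc : c ∈ boxAlg A)
    (hf : ∀ x y, c (x, y) = f y - f (x * y) + f x) :
    IsUnipotentHopf ρ (A ⊔ Algebra.adjoin k {f}) := by
  set B := A ⊔ Algebra.adjoin k {f} with hB
  have hAB : A ≤ B := le_sup_left
  have hfB : f ∈ B := (le_sup_right : _ ≤ B) (Algebra.self_mem_adjoin_singleton k f)
  refine .of_adjoin (A ∪ {f})
    (hA.fg.sup ⟨{f}, by simp⟩) (sup_le ?_ ?_) ?_ ?_ (hA.base.trans hAB) ?_
  · exact fun a ha => Algebra.subset_adjoin (Or.inl ha)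
  · exact Algebra.adjoin_mono Set.subset_union_right
  · rintro a (ha | rfl)
    · exact boxAlg_mono hAB (hA.comul_mem a ha)
    -- The coboundary relation says that f is primitive up to c: Δf = f ⊗ 1 + 1 ⊗ f − c.
    · have e : comul k Γ a = (fun x => a x.1 * (1 : Γ → k) x.2) +
          (fun x => (1 : Γ → k) x.1 * a x.2) - c := by
        funext ⟨x, y⟩
        change a (x * y) = a x * 1 + 1 * a y - c (x, y)
        rw [hf]
        ring
      rw [e]
      exact sub_mem (add_mem (mul_mem_boxAlg hfB B.one_mem) (mul_mem_boxAlg B.one_mem hfB))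
        (boxAlg_mono hAB hc)
  · rintro a (ha | rfl)
    · exact hAB (hA.inv_mem a ha)
    -- The relation at (x, x⁻¹) gives f(x⁻¹) = c(x, x⁻¹) + f(1) − f(x), and c restricted to the
    -- antidiagonal lies in A.
    · have hdiag : boxAlg A ≤ A.comap (AlgHom.pi fun x => Pi.evalAlgHom k _ (x, x⁻¹)) := by
        refine box_le (N := Subalgebra.toSubmodule
          (A.comap (AlgHom.pi fun x : Γ => Pi.evalAlgHom k _ (x, x⁻¹)))) fun p hp q hq => ?_
        exact A.mul_mem hp (hA.inv_mem q hq)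
      have e : invPull k Γ a =
          (AlgHom.pi fun x => Pi.evalAlgHom k _ (x, x⁻¹) : (Γ × Γ → k) →ₐ[k] (Γ → k)) c +
            algebraMap k _ (a 1) - a := by
        funext x
        change a x⁻¹ = c (x, x⁻¹) + a 1 - a x
        rw [hf, mul_inv_cancel]
        ring
      rw [e]
      exact sub_mem (add_mem (hAB (hdiag hc)) (B.algebraMap_mem _)) hfB
  · rintro a (ha | rfl)
    · obtain ⟨i, hi⟩ := hA.unip a ha
      exact ⟨i, fil_mono_left hAB (kerSpan_mono hAB) i hi⟩
    · obtain ⟨i, hi⟩ := hA.exists_mem_box hc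
      -- Here `diff` sends f to 1 ⊗ f − c. The left factors lie in level 1 for the first term and
      -- level i for the second, both inside level i + 1, so f has level i + 2.
      refine ⟨i + 2, mem_fil_succ.2 ⟨hfB, Submodule.mem_sup_left ?_⟩⟩
      have e : diff k Γ a = (fun x => (1 : Γ → k) x.1 * a x.2) - c := by
        funext ⟨x, y⟩
        rw [diff_apply]
        change a (x * y) - a x = 1 * a y - c (x, y)
        rw [hf]
        ring
      rw [e]
      refine sub_mem (mul_mem_box (fil_mono _ _ (by omega) one_mem_fil) hfB) ?_
      exact box_mono ((fil_mono_left hAB (kerSpan_mono hAB) i).trans (fil_le_succ _ _ i)) hAB hi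

end Hopf

/-! ### Matrix coefficients of representations with a unipotent flag -/

section Matrices

open Matrix

variable {k Γ : Type u} [Field k] {n : ℕ} {A : Subalgebra k (Γ → k)}

theorem coef_mem {σ : Γ → Matrix (Fin n) (Fin n) k} (hσ : ∀ i j, (fun γ => σ γ i j) ∈ A)
    (l : Module.Dual k (Fin n → k)) (v : Fin n → k) : (fun γ => l (σ γ *ᵥ v)) ∈ A := by
  have e : (fun γ => l (σ γ *ᵥ v)) = ∑ i, ∑ j,
      (l fun j => if i = j then 1 else 0) • v j • fun γ => σ γ i j := by
    funext γ
    rw [LinearMap.pi_apply_eq_sum_univ l]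
    simp only [Finset.sum_apply, Pi.smul_apply, smul_eq_mul, mulVec, dotProduct, Finset.sum_mul]
    exact Finset.sum_congr rfl fun i _ => Finset.sum_congr rfl fun j _ => by ring
  rw [e]
  exact A.sum_mem fun i _ => A.sum_mem fun j _ => A.smul_mem (A.smul_mem (hσ i j) _) _

theorem exists_projection (W : Submodule k (Fin n → k)) :
    ∃ P : (Fin n → k) →ₗ[k] (Fin n → k), (∀ w, P w ∈ W) ∧ ∀ w ∈ W, P w = w := by
  obtain ⟨g, hg⟩ := W.subtype.exists_leftInverse_of_injective W.ker_subtype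
  exact ⟨W.subtype ∘ₗ g, fun w => (g w).2, fun w hw =>
    congrArg Subtype.val (LinearMap.congr_fun hg ⟨w, hw⟩)⟩

variable [Group Γ] {τ : Γ →* Matrix.GeneralLinearGroup (Fin n) k} {J : Submodule k (Γ → k)}

/-- With w = τ(y)v − v, the variation of the coefficient is l(τ(x)w). Let P project onto V (i + 1).
The part Pw contributes coefficients of vectors one step deeper in the flag, covered by induction;
the coordinates of w − Pw lie in J, since id − P kills V (i + 1). -/
theorem coef_mem_fil (hτ : coordAlg τ ≤ A) {V : ℕ → Submodule k (Fin n → k)} {m : ℕ}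
    (hm : V m = ⊥)
    (hV : ∀ i, ∀ v ∈ V i, ∀ l : Module.Dual k (Fin n → k), (∀ w ∈ V (i + 1), l w = 0) →
      (fun γ => l ((τ γ : Matrix (Fin n) (Fin n) k) *ᵥ v - v)) ∈ J) (j : ℕ) :
    ∀ i, i + j = m → ∀ v ∈ V i, ∀ l : Module.Dual k (Fin n → k),
      (fun γ => l ((τ γ : Matrix (Fin n) (Fin n) k) *ᵥ v)) ∈ fil A J j := by
  have hA := coef_mem (σ := fun γ => (τ γ : Matrix (Fin n) (Fin n) k))
    fun i j => hτ (entry_mem_coordAlg τ i j)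
  induction j with
  | zero =>
    intro i hi v hv l
    rw [show i = m from hi, hm] at hv
    rw [show v = 0 from hv]
    simp only [mulVec_zero, map_zero]
    exact Submodule.zero_mem _
  | succ j ih =>
    intro i hi v hv l
    refine mem_fil_succ.2 ⟨hA l v, ?_⟩
    obtain ⟨P, hP, hPW⟩ := exists_projection (V (i + 1))
    have e : diff k Γ (fun γ => l ((τ γ : Matrix (Fin n) (Fin n) k) *ᵥ v)) =
        (∑ a, fun x : Γ × Γ =>
          l ((τ x.1 : Matrix (Fin n) (Fin n) k) *ᵥ P (fun b => if a = b then 1 else 0)) *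
            (LinearMap.proj a : (Fin n → k) →ₗ[k] k)
              ((τ x.2 : Matrix (Fin n) (Fin n) k) *ᵥ v - v)) +
        ∑ a, fun x : Γ × Γ =>
          l ((τ x.1 : Matrix (Fin n) (Fin n) k) *ᵥ (fun b => if a = b then 1 else 0)) *
            ((LinearMap.proj a : (Fin n → k) →ₗ[k] k) ∘ₗ (LinearMap.id - P))
              ((τ x.2 : Matrix (Fin n) (Fin n) k) *ᵥ v - v) := by
      funext ⟨x, y⟩
      set w := (τ y : Matrix (Fin n) (Fin n) k) *ᵥ v - v with hw
      have h1 := LinearMap.pi_apply_eq_sum_univ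
        (l ∘ₗ (τ x : Matrix (Fin n) (Fin n) k).mulVecLin ∘ₗ P) w
      have h2 := LinearMap.pi_apply_eq_sum_univ
        (l ∘ₗ (τ x : Matrix (Fin n) (Fin n) k).mulVecLin) (w - P w)
      rw [diff_apply]
      simp only [Pi.add_apply, Finset.sum_apply]
      have h0 : l ((τ (x * y) : Matrix (Fin n) (Fin n) k) *ᵥ v) -
          l ((τ x : Matrix (Fin n) (Fin n) k) *ᵥ v) =
          l ((τ x : Matrix (Fin n) (Fin n) k) *ᵥ (P w)) +
          l ((τ x : Matrix (Fin n) (Fin n) k) *ᵥ (w - P w)) := by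
        rw [← map_add, ← mulVec_add, add_sub_cancel, hw, mulVec_sub, map_sub, map_mul,
          Units.val_mul, mulVec_mulVec]
      rw [h0]
      refine congrArg₂ (· + ·) (h1.trans ?_) (h2.trans ?_)
      · exact Finset.sum_congr rfl fun a _ => mul_comm _ _
      · exact Finset.sum_congr rfl fun a _ => mul_comm _ _
    rw [e]
    refine add_mem (Submodule.mem_sup_left (Submodule.sum_mem _ fun a _ => ?_))
      (Submodule.mem_sup_right (Submodule.sum_mem _ fun a _ => ?_))
    · refine mul_mem_box (ih (i + 1) (by omega) _ (hP _) l)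
        (q := fun y => (LinearMap.proj a : (Fin n → k) →ₗ[k] k)
          ((τ y : Matrix (Fin n) (Fin n) k) *ᵥ v - v)) ?_
      exact A.sub_mem (hA (LinearMap.proj a) v) (A.algebraMap_mem (v a))
    · exact mul_mem_box (P := Subalgebra.toSubmodule A) (hA l _) (hV i v hv _ fun w hw => by
        simp [hPW w hw])

/-- Inversion reverses products, so the roles of vector and form are exchanged: the induction runs
over the annihilators of the flag. With w = τ(x⁻¹)v and P the projection onto V j, the forms giving
w − Pw kill V j and fall under the induction hypothesis, while for Pw the right-hand factor lies in
J. -/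
theorem inv_coef_mem_fil (hτ : coordAlg τ ≤ A) {V : ℕ → Submodule k (Fin n → k)}
    (h0 : V 0 = ⊤)
    (hV : ∀ i, ∀ v ∈ V i, ∀ l : Module.Dual k (Fin n → k), (∀ w ∈ V (i + 1), l w = 0) →
      (fun γ => l ((τ γ⁻¹ : Matrix (Fin n) (Fin n) k) *ᵥ v - v)) ∈ J) (j : ℕ) :
    ∀ (v : Fin n → k) (l : Module.Dual k (Fin n → k)), (∀ w ∈ V j, l w = 0) →
      (fun γ => l ((τ γ⁻¹ : Matrix (Fin n) (Fin n) k) *ᵥ v)) ∈ fil A J j := by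
  have hA := coef_mem (σ := fun γ => (τ γ⁻¹ : Matrix (Fin n) (Fin n) k))
    fun i j => hτ (inv_entry_mem_coordAlg τ i j)
  induction j with
  | zero =>
    intro v l hl
    have : l = 0 := LinearMap.ext fun w => hl w (h0 ▸ Submodule.mem_top)
    subst this
    exact Submodule.zero_mem _
  | succ j ih =>
    intro v l hl
    refine mem_fil_succ.2 ⟨hA l v, ?_⟩
    obtain ⟨P, hP, hPW⟩ := exists_projection (V j)
    have e : diff k Γ (fun γ => l ((τ γ⁻¹ : Matrix (Fin n) (Fin n) k) *ᵥ v)) =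
        (∑ a, fun x : Γ × Γ =>
          ((LinearMap.proj a : (Fin n → k) →ₗ[k] k) ∘ₗ (LinearMap.id - P))
              ((τ x.1⁻¹ : Matrix (Fin n) (Fin n) k) *ᵥ v) *
          l ((τ x.2⁻¹ : Matrix (Fin n) (Fin n) k) *ᵥ (fun b => if a = b then 1 else 0) -
            (fun b => if a = b then 1 else 0))) +
        ∑ a, fun x : Γ × Γ =>
          (LinearMap.proj a : (Fin n → k) →ₗ[k] k)
              ((τ x.1⁻¹ : Matrix (Fin n) (Fin n) k) *ᵥ v) *
          l ((τ x.2⁻¹ : Matrix (Fin n) (Fin n) k) *ᵥ P (fun b => if a = b then 1 else 0) -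
            P (fun b => if a = b then 1 else 0)) := by
      funext ⟨x, y⟩
      set w := (τ x⁻¹ : Matrix (Fin n) (Fin n) k) *ᵥ v with hw
      have h1 := LinearMap.pi_apply_eq_sum_univ
        (l ∘ₗ ((τ y⁻¹ : Matrix (Fin n) (Fin n) k).mulVecLin - LinearMap.id)) (w - P w)
      have h2 := LinearMap.pi_apply_eq_sum_univ
        (l ∘ₗ ((τ y⁻¹ : Matrix (Fin n) (Fin n) k).mulVecLin - LinearMap.id) ∘ₗ P) w
      rw [diff_apply]
      simp only [Pi.add_apply, Finset.sum_apply]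
      have h0 : l ((τ (x * y)⁻¹ : Matrix (Fin n) (Fin n) k) *ᵥ v) - l w =
          l ((τ y⁻¹ : Matrix (Fin n) (Fin n) k) *ᵥ (w - P w) - (w - P w)) +
          l ((τ y⁻¹ : Matrix (Fin n) (Fin n) k) *ᵥ (P w) - P w) := by
        rw [_root_.mul_inv_rev, map_mul, Units.val_mul, ← mulVec_mulVec, ← hw, ← map_sub, ← map_add,
          mulVec_sub]
        congr 1
        abel
      rw [h0]
      exact congrArg₂ (· + ·) h1 h2
    rw [e]
    refine add_mem (Submodule.mem_sup_left (Submodule.sum_mem _ fun a _ => ?_))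
      (Submodule.mem_sup_right (Submodule.sum_mem _ fun a _ => ?_))
    · refine mul_mem_box (ih v ((LinearMap.proj a : (Fin n → k) →ₗ[k] k) ∘ₗ (LinearMap.id - P))
        fun w hw => by simp [hPW w hw])
        (q := fun y => l ((τ y⁻¹ : Matrix (Fin n) (Fin n) k) *ᵥ
          (fun b => if a = b then 1 else 0) - (fun b => if a = b then 1 else 0))) ?_
      simp only [map_sub]
      exact A.sub_mem (hA _ _) (A.algebraMap_mem _)
    · exact mul_mem_box (P := Subalgebra.toSubmodule A) (hA (LinearMap.proj a) v)
        (hV j _ (hP _) l hl)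

end Matrices

/-! ### The function algebra of a diagram -/

section OfDiagram

variable {k Γ : Type u} [Field k] [Group Γ] {S : LinAlgGroup k} {ρ : Γ →* S.points}

theorem Diagram.pull_kernelIdeal (α : Diagram S ρ) {f : α.E.regular}
    (hf : f ∈ kernelIdeal α.π) :
    (fun γ => (f : α.E.points → k) (α.lift γ)) ∈ kerSpan ρ (liftAlg α.lift) := by
  induction hf using Submodule.span_induction with
  | mem f hf =>
    obtain ⟨h, hh, h1, hfh⟩ := hf
    convert mem_kerSpan (ρ := ρ) (liftAlg α.lift).one_mem hh h1 using 1
    funext γ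
    rw [hfh, α.comm]
    exact (one_mul _).symm
  | zero => exact Submodule.zero_mem _
  | add a b _ _ ha hb => exact add_mem ha hb
  | smul a b _ hb => exact mul_mem_kerSpan _ (mem_liftAlg.2 ⟨a.1, a.2, fun _ => rfl⟩) _ hb

theorem Diagram.base_le (α : Diagram S ρ) : liftAlg ρ ≤ liftAlg α.lift := by
  intro f hf
  obtain ⟨F, hF, h⟩ := mem_liftAlg.1 hf
  exact mem_liftAlg.2 ⟨_, α.algebraic F hF, fun γ => by rw [α.comm, h]⟩

open Matrix in
theorem Diagram.isUnipotentHopf (α : Diagram S ρ) : IsUnipotentHopf ρ (liftAlg α.lift) := by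
  set τ := α.E.points.subtype.comp α.lift with hτ
  set A := coordAlg τ with hA
  have hinv : A ≤ A.comap (invPull k Γ) := coordAlg_le (fun i j => inv_entry_mem_coordAlg τ i j)
    fun i j => by
      have := entry_mem_coordAlg τ i j
      have e : invPull k Γ (fun γ => (τ γ⁻¹ : Matrix (Fin α.E.n) (Fin α.E.n) k) i j) =
          fun γ => (τ γ : Matrix (Fin α.E.n) (Fin α.E.n) k) i j := by
        funext γ
        change (τ γ⁻¹⁻¹ : Matrix (Fin α.E.n) (Fin α.E.n) k) i j = _
        rw [inv_inv]
      rw [Subalgebra.mem_comap, e]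
      exact this
  have hcomul : A ≤ (boxAlg A).comap (comul k Γ) := by
    refine coordAlg_le (fun i j => ?_) fun i j => ?_
    · rw [Subalgebra.mem_comap]
      have e : comul k Γ (fun γ => (τ γ : Matrix (Fin α.E.n) (Fin α.E.n) k) i j) =
          ∑ l, fun x : Γ × Γ => (τ x.1 : Matrix (Fin α.E.n) (Fin α.E.n) k) i l *
            (τ x.2 : Matrix (Fin α.E.n) (Fin α.E.n) k) l j := by
        funext x
        change (τ (x.1 * x.2) : Matrix (Fin α.E.n) (Fin α.E.n) k) i j = _
        rw [map_mul, Units.val_mul, Matrix.mul_apply, Finset.sum_apply]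
      rw [e]
      exact Subalgebra.sum_mem _ fun l _ => mul_mem_boxAlg
        (entry_mem_coordAlg τ i l) (entry_mem_coordAlg τ l j)
    · rw [Subalgebra.mem_comap]
      have e : comul k Γ (fun γ => (τ γ⁻¹ : Matrix (Fin α.E.n) (Fin α.E.n) k) i j) =
          ∑ l, fun x : Γ × Γ => (τ x.1⁻¹ : Matrix (Fin α.E.n) (Fin α.E.n) k) l j *
            (τ x.2⁻¹ : Matrix (Fin α.E.n) (Fin α.E.n) k) i l := by
        funext x
        change (τ (x.1 * x.2)⁻¹ : Matrix (Fin α.E.n) (Fin α.E.n) k) i j = _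
        rw [_root_.mul_inv_rev, map_mul, Units.val_mul, Matrix.mul_apply, Finset.sum_apply]
        exact Finset.sum_congr rfl fun l _ => mul_comm _ _
      rw [e]
      exact Subalgebra.sum_mem _ fun l _ => mul_mem_boxAlg
        (inv_entry_mem_coordAlg τ l j) (inv_entry_mem_coordAlg τ i l)
  obtain ⟨m, V, h0, -, hm, hV⟩ := α.unipotent
  have hV1 : ∀ i, ∀ v ∈ V i, ∀ l : Module.Dual k (Fin α.E.n → k), (∀ w ∈ V (i + 1), l w = 0) →
      (fun γ => l ((τ γ : Matrix (Fin α.E.n) (Fin α.E.n) k) *ᵥ v - v)) ∈ kerSpan ρ A := by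
    intro i v hv l hl
    obtain ⟨f, hf, hfg⟩ := hV i v hv l hl
    have e : (fun γ => l ((τ γ : Matrix (Fin α.E.n) (Fin α.E.n) k) *ᵥ v - v)) =
        fun γ => (f : α.E.points → k) (α.lift γ) := funext fun γ => (hfg (α.lift γ)).symm
    rw [e]
    exact α.pull_kernelIdeal hf
  -- The ideal of the kernel is stable under inversion, so the flag condition passes from γ to γ⁻¹.
  have hV2 : ∀ i, ∀ v ∈ V i, ∀ l : Module.Dual k (Fin α.E.n → k), (∀ w ∈ V (i + 1), l w = 0) →
      (fun γ => l ((τ γ⁻¹ : Matrix (Fin α.E.n) (Fin α.E.n) k) *ᵥ v - v)) ∈ kerSpan ρ A :=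
    fun i v hv l hl => invPull_mem_kerSpan hinv (hV1 i v hv l hl)
  refine ⟨coordAlg_fg τ, hcomul, hinv, α.base_le, ?_⟩
  have e (M : Matrix (Fin α.E.n) (Fin α.E.n) k) (i j) :
      M i j = (LinearMap.proj i : (Fin α.E.n → k) →ₗ[k] k) (M *ᵥ Pi.single j 1) := by simp
  refine coordAlg_le (A := filUnion (A := A) (J := kerSpan ρ A) mul_mem_kerSpan
    (kerSpan_le_self α.base_le)) (fun i j => ⟨m, ?_⟩) fun i j => ⟨m, ?_⟩
  · simp only [e]
    exact coef_mem_fil le_rfl hm hV1 m 0 (zero_add m) _ (h0 ▸ Submodule.mem_top) _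
  · simp only [e]
    exact inv_coef_mem_fil le_rfl h0 hV2 m _ _ fun w hw => by
      rw [hm] at hw
      rw [show w = 0 from hw, map_zero]

end OfDiagram

/-! ### Diagrams from algebras of functions -/

section Realization

variable {k Γ : Type u} [Field k] [Group Γ] {S : LinAlgGroup k} {ρ : Γ →* S.points}

/-- The right regular representation. -/
def rightTrans (k : Type u) [Field k] (y : Γ) : (Γ → k) →ₗ[k] (Γ → k) :=
  LinearMap.funLeft k k fun x => x * y

/-- `A` is generated by a finite dimensional subrepresentation of the right regular
representation. -/
theorem IsUnipotentHopf.exists_generating {A : Subalgebra k (Γ → k)}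
    (hA : IsUnipotentHopf ρ A) :
    ∃ M : Submodule k (Γ → k), FiniteDimensional k M ∧ M ≤ Subalgebra.toSubmodule A ∧
      (∀ y, ∀ a ∈ M, rightTrans k y a ∈ M) ∧ A ≤ Algebra.adjoin k (M : Set (Γ → k)) := by
  obtain ⟨s, hs⟩ := hA.fg
  have hsA : ∀ a ∈ s, a ∈ A := fun a ha => hs ▸ Algebra.subset_adjoin ha
  have hW : ∀ a : s, ∃ W ≤ Subalgebra.toSubmodule A, W.FG ∧ ∀ y, rightTrans k y a ∈ W :=
    fun a => exists_fg_slice (hA.comul_mem a (hsA a a.2))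
  choose W hWA hWfg hW using hW
  -- The spaces W a need not be translation stable. The span of all translates is, and their sum
  -- only serves to bound its dimension.
  set M := Submodule.span k {f | ∃ y : Γ, ∃ a ∈ s, f = rightTrans k y a} with hM
  have hMW : M ≤ ⨆ a, W a := by
    refine Submodule.span_le.2 ?_
    rintro _ ⟨y, a, ha, rfl⟩
    exact Submodule.mem_iSup_of_mem ⟨a, ha⟩ (hW ⟨a, ha⟩ y)
  have hfin : FiniteDimensional k (⨆ a, W a : Submodule k (Γ → k)) :=
    Module.Finite.iff_fg.2 (Submodule.fg_iSup W hWfg)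
  refine ⟨M, Submodule.finiteDimensional_of_le hMW, hMW.trans (iSup_le hWA), ?_, ?_⟩
  · intro y a ha
    have : M ≤ M.comap (rightTrans k y) := by
      refine Submodule.span_le.2 ?_
      rintro _ ⟨z, a, ha, rfl⟩
      refine Submodule.subset_span ⟨y * z, a, ha, funext fun x => ?_⟩
      exact congrArg a (mul_assoc x y z)
    exact this ha
  · rw [← hs]
    refine Algebra.adjoin_mono fun a ha => Submodule.subset_span ⟨1, a, ha, funext fun x => ?_⟩
    exact congrArg a (mul_one x).symm

theorem IsUnipotentHopf.exists_le_fil {A : Subalgebra k (Γ → k)} (hA : IsUnipotentHopf ρ A)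
    {M : Submodule k (Γ → k)} (hM : M.FG) (hMA : M ≤ Subalgebra.toSubmodule A) :
    ∃ m, M ≤ fil A (kerSpan ρ A) m := by
  obtain ⟨s, rfl⟩ := hM
  have : ∀ a : s, ∃ i, (a : Γ → k) ∈ fil A (kerSpan ρ A) i := fun a =>
    hA.unip a (hMA (Submodule.subset_span a.2))
  choose i hi using this
  refine ⟨Finset.univ.sup i, Submodule.span_le.2 fun a ha => ?_⟩
  exact fil_mono _ _ (Finset.le_sup (Finset.mem_univ (⟨a, ha⟩ : s))) (hi ⟨a, ha⟩)

/-- A linear form killing `fil j` maps the variation of an element of `fil (j + 1)` to `J`. -/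
theorem dual_apply_mem {W : Type u} [AddCommGroup W] [Module k W] {incl : W →ₗ[k] (Γ → k)}
    {A : Subalgebra k (Γ → k)} {J : Submodule k (Γ → k)} {j : ℕ} {v : W}
    (hv : incl v ∈ fil A J (j + 1)) {l : Module.Dual k W}
    (hl : ∀ w ∈ (fil A J j).comap incl, l w = 0) {φ : Γ → W}
    (hφ : ∀ y, incl (φ y) = fun x => diff k Γ (incl v) (x, y)) : (fun y => l (φ y)) ∈ J := by
  set N := fil A J j with hN
  -- As l vanishes on the preimage of N, it extends to a linear form on all functions modulo N. That
  -- form kills the N ⊗ A part of the variation and leaves a slice of the A ⊗ J part.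
  have hl' : l ∈ LinearMap.range (N.mkQ ∘ₗ incl).dualMap := by
    rw [LinearMap.range_dualMap_eq_dualAnnihilator_ker, Submodule.mem_dualAnnihilator]
    intro w hw
    refine hl w ?_
    rwa [LinearMap.ker_comp, Submodule.ker_mkQ] at hw
  obtain ⟨l', rfl⟩ := hl'
  obtain ⟨F, hF, G, hG, hFG⟩ := Submodule.mem_sup.1 (mem_fil_succ.1 hv).2
  have e (y : Γ) : (N.mkQ ∘ₗ incl).dualMap l' (φ y) = (l' ∘ₗ N.mkQ) fun x => G (x, y) := by
    have h1 : incl (φ y) = (fun x => F (x, y)) + fun x => G (x, y) := by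
      rw [hφ, ← hFG]
      rfl
    have h2 : (l' ∘ₗ N.mkQ) (fun x => F (x, y)) = 0 :=
      slice_eq_zero hF (fun p hp => by
        rw [LinearMap.comp_apply, Submodule.mkQ_apply, (Submodule.Quotient.mk_eq_zero N).2 hp,
          map_zero]) y
    change (l' ∘ₗ N.mkQ) (incl (φ y)) = _
    rw [h1, map_add, h2, zero_add]
  rw [funext e]
  exact slice_mem hG _

open Matrix in
/-- `A` is the algebra of functions defined by a representation of `Γ` which is unipotent on the
kernel of `ρ`. -/
theorem IsUnipotentHopf.exists_representation {A : Subalgebra k (Γ → k)}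
    (hA : IsUnipotentHopf ρ A) :
    ∃ (n : ℕ) (τ : Γ →* Matrix.GeneralLinearGroup (Fin n) k), coordAlg τ = A ∧
      ∃ (m : ℕ) (V : ℕ → Submodule k (Fin n → k)), V 0 = ⊤ ∧ Antitone V ∧ V m = ⊥ ∧
        ∀ i, ∀ v ∈ V i, ∀ l : Module.Dual k (Fin n → k), (∀ w ∈ V (i + 1), l w = 0) →
          (fun γ => l ((τ γ : Matrix (Fin n) (Fin n) k) *ᵥ v - v)) ∈ kerSpan ρ A := by
  obtain ⟨M, hfin, hMA, hMtrans, hgen⟩ := hA.exists_generating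
  obtain ⟨n, ⟨b⟩⟩ : ∃ n, Nonempty (Module.Basis (Fin n) k M) := ⟨_, ⟨Module.finBasis k M⟩⟩
  let r : Γ →* Module.End k M :=
    { toFun := fun y => (rightTrans k y).restrict (hMtrans y)
      map_one' := LinearMap.ext fun a => Subtype.ext (funext fun x =>
        congrArg a.1 (mul_one x))
      map_mul' := fun y z => LinearMap.ext fun a => Subtype.ext (funext fun x =>
        congrArg a.1 (mul_assoc x y z).symm) }
  obtain ⟨τ, hτ⟩ : ∃ τ : Γ →* Matrix.GeneralLinearGroup (Fin n) k, ∀ y v,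
      (τ y : Matrix (Fin n) (Fin n) k) *ᵥ v = b.equivFun (r y (b.equivFun.symm v)) := by
    refine ⟨(Units.map (LinearMap.toMatrixAlgEquiv b : Module.End k M →* Matrix _ _ k)).comp
      r.toHomUnits, fun y v => ?_⟩
    have := LinearMap.toMatrix_mulVec_repr b b (r y) (b.equivFun.symm v)
    rw [← b.equivFun_apply, ← b.equivFun_apply, LinearEquiv.apply_symm_apply] at this
    exact this
  have hentry (i j) : (fun γ => (τ γ : Matrix (Fin n) (Fin n) k) i j) ∈ A := by
    -- Extending the coordinate form from M to all functions on Γ exhibits the matrix entry as a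
    -- slice of the comultiplication.
    obtain ⟨l, hl⟩ := LinearMap.exists_extend (b.coord i)
    have := slice_mem (hA.comul_mem _ (hMA (b j).2)) l
    have e : (fun γ => (τ γ : Matrix (Fin n) (Fin n) k) i j) =
        fun y => l fun x => comul k Γ (b j : Γ → k) (x, y) := by
      funext y
      have h1 : (τ y : Matrix (Fin n) (Fin n) k) i j = b.coord i (r y (b j)) := by
        have := congrFun (hτ y (Pi.single j 1)) i
        rw [mulVec_single_one] at this
        simpa [Module.Basis.equivFun_symm_apply, Pi.single_apply] using this
      rw [h1, ← hl]
      rfl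
    rw [e]
    exact this
  have hτA : coordAlg τ = A := by
    refine le_antisymm (coordAlg_le hentry fun i j => hA.inv_mem _ (hentry i j))
      (hgen.trans (Algebra.adjoin_le fun a ha => ?_))
    -- Evaluation at 1 recovers a from its translates, so each a in M is a matrix coefficient.
    let l : Module.Dual k (Fin n → k) :=
      LinearMap.proj (1 : Γ) ∘ₗ M.subtype ∘ₗ b.equivFun.symm.toLinearMap
    have e : a = fun γ => l ((τ γ : Matrix _ _ k) *ᵥ b.equivFun ⟨a, ha⟩) := by
      funext γ
      rw [hτ, LinearEquiv.symm_apply_apply]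
      change a γ = (b.equivFun.symm (b.equivFun (r γ ⟨a, ha⟩)) : Γ → k) 1
      rw [LinearEquiv.symm_apply_apply]
      exact congrArg a (one_mul γ).symm
    exact Set.mem_of_eq_of_mem e (coef_mem (A := coordAlg τ)
      (σ := fun γ => (τ γ : Matrix (Fin n) (Fin n) k)) (entry_mem_coordAlg τ) l _)
  obtain ⟨m, hm⟩ := hA.exists_le_fil (Module.Finite.iff_fg.1 hfin) hMA
  let incl : (Fin n → k) →ₗ[k] (Γ → k) :=
    M.subtype ∘ₗ b.equivFun.symm.toLinearMap
  have hincl : Function.Injective incl := M.subtype_injective.comp b.equivFun.symm.injective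
  -- The flag is the increasing filtration of M read backwards. For i ≥ m the truncated m - i is 0
  -- and the step is zero, a case treated separately below.
  refine ⟨_, τ, hτA, m, fun i => (fil A (kerSpan ρ A) (m - i)).comap incl, ?_, ?_,
    ?_, ?_⟩
  · refine eq_top_iff.2 fun v _ => hm ?_
    exact (b.equivFun.symm v).2
  · exact fun i j hij => Submodule.comap_mono (fil_mono _ _ (by omega))
  · simp only [Nat.sub_self]
    exact LinearMap.ker_eq_bot.2 hincl
  · intro i v hv l hl
    replace hv : incl v ∈ fil A (kerSpan ρ A) (m - i) := hv
    rcases Nat.eq_zero_or_pos (m - i) with hi | hi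
    · rw [hi] at hv
      rw [show v = 0 from hincl (hv.trans incl.map_zero.symm)]
      simp only [mulVec_zero, sub_zero, map_zero]
      exact Submodule.zero_mem _
    · rw [show m - i = m - (i + 1) + 1 by omega] at hv
      refine dual_apply_mem hv hl fun y => ?_
      rw [map_sub, hτ]
      change (b.equivFun.symm (b.equivFun (r y (b.equivFun.symm v))) : Γ → k) - incl v = _
      rw [LinearEquiv.symm_apply_apply]
      rfl

theorem exists_mem_kernelIdeal {G : LinAlgGroup k} {lift : Γ →* G.points}
    {π : G.points →* S.points} (hπ : IsAlgebraicHom π) (hπρ : ∀ γ, π (lift γ) = ρ γ)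
    {a : Γ → k} (ha : a ∈ kerSpan ρ (liftAlg lift)) :
    ∃ f ∈ kernelIdeal π, ∀ γ, (f : G.points → k) (lift γ) = a γ := by
  induction ha using Submodule.span_induction with
  | mem a ha =>
    obtain ⟨b, hb, h, hh, h1, rfl⟩ := ha
    obtain ⟨B, hB, hBb⟩ := mem_liftAlg.1 hb
    refine ⟨(⟨B, hB⟩ : G.regular) * ⟨_, hπ h hh⟩,
      Ideal.mul_mem_left _ _ (Ideal.subset_span ⟨h, hh, h1, fun _ => rfl⟩), fun γ => ?_⟩
    change B (lift γ) * h (π (lift γ)) = b γ * h (ρ γ)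
    rw [hBb, hπρ]
  | zero => exact ⟨0, Ideal.zero_mem _, fun _ => rfl⟩
  | add a b _ _ ha hb =>
    obtain ⟨f, hf, hfa⟩ := ha
    obtain ⟨g, hg, hgb⟩ := hb
    exact ⟨f + g, Ideal.add_mem _ hf hg, fun γ => congrArg₂ (· + ·) (hfa γ) (hgb γ)⟩
  | smul c a _ ha =>
    obtain ⟨f, hf, hfa⟩ := ha
    refine ⟨algebraMap k _ c * f, Ideal.mul_mem_left _ _ hf, fun γ => ?_⟩
    exact congrArg (c * ·) (hfa γ)

/-- The group is the Zariski closure of the image of the representation with algebra A. Its map to S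
exists because A contains the functions coming from S, and the flag condition spreads from Γ to the
closure by density. -/
theorem IsUnipotentHopf.exists_diagram (hρ : Function.Surjective ρ)
    {A : Subalgebra k (Γ → k)} (hA : IsUnipotentHopf ρ A) :
    ∃ α : Diagram S ρ, liftAlg α.lift = A := by
  obtain ⟨n, τ, rfl, m, V, h0, hanti, hm, hV⟩ := hA.exists_representation
  let E := zariskiClosure τ
  let lift : Γ →* E.points := toZariskiClosure τ
  have hd : HasDenseImage lift := toZariskiClosure_dense τ
  obtain ⟨π, hπ, hπρ⟩ := hd.exists_extension ρ hA.base
  refine ⟨⟨E, π, hπ, fun s => ?_, ⟨m, V, h0, hanti, hm, ?_⟩, lift, hd, hπρ⟩, rfl⟩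
  · obtain ⟨γ, rfl⟩ := hρ s
    exact ⟨lift γ, hπρ γ⟩
  · intro i (v : Fin n → k) hv (l : Module.Dual k (Fin n → k)) hl
    obtain ⟨f, hf, hfl⟩ := exists_mem_kernelIdeal hπ hπρ (hV i v hv l hl)
    have hreg : (fun g : Matrix.GeneralLinearGroup (Fin n) k =>
        l ((g : Matrix (Fin n) (Fin n) k).mulVec v - v)) ∈ glRegular k n := by
      simp only [map_sub]
      exact (glRegular k n).sub_mem (coef_mem entry_mem_glRegular l v)
        ((glRegular k n).algebraMap_mem (l v))
    exact ⟨f, hf, congrFun (hd.eq f.2 (E.restrict_mem hreg) hfl)⟩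

theorem Diagram.isDirectedOrder (hρ : Function.Surjective ρ) :
    IsDirectedOrder (Diagram S ρ) where
  directed α β := by
    obtain ⟨δ, hδ⟩ := (α.isUnipotentHopf.sup β.isUnipotentHopf).exists_diagram hρ
    exact ⟨δ, Diagram.le_of_liftAlg_le (hδ ▸ le_sup_left),
      Diagram.le_of_liftAlg_le (hδ ▸ le_sup_right)⟩

theorem Diagram.nonempty (hρ : Function.Surjective ρ) : Nonempty (Diagram S ρ) := by
  -- S itself, with trivial kernel and a one-step flag: g ↦ l(gv − v) vanishes at 1, so it lies in
  -- the kernel ideal of the identity.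
  refine ⟨⟨S, MonoidHom.id _, fun _ hf => hf, Function.surjective_id,
    ⟨1, fun i => if i = 0 then ⊤ else ⊥, if_pos rfl, ?_, if_neg one_ne_zero, ?_⟩, ρ, ?_,
    fun _ => rfl⟩⟩
  · intro i j hij
    by_cases hi : i = 0
    · simp [hi]
    · simp [hi, show j ≠ 0 by omega]
  · intro i v _ l hl
    have hreg : (fun g : Matrix.GeneralLinearGroup (Fin S.n) k =>
        l ((g : Matrix (Fin S.n) (Fin S.n) k).mulVec v - v)) ∈ glRegular k S.n := by
      simp only [map_sub]
      exact (glRegular k S.n).sub_mem (coef_mem entry_mem_glRegular l v)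
        ((glRegular k S.n).algebraMap_mem (l v))
    exact ⟨⟨_, S.restrict_mem hreg⟩,
      Ideal.subset_span ⟨_, S.restrict_mem hreg, by simp, fun _ => rfl⟩, fun _ => rfl⟩
  · intro f _ h
    funext s
    obtain ⟨γ, rfl⟩ := hρ s
    exact h γ

end Realization

/-! ### Injectivity on the second cohomology -/

section Injectivity

variable {k Γ : Type u} [Field k] [Group Γ] {S : LinAlgGroup k} {ρ : Γ →* S.points}

theorem pull_regular₂ {G : LinAlgGroup k} (lift : Γ →* G.points) {c : G.points × G.points → k}
    (hc : c ∈ G.regular₂) : pull₂ k lift c ∈ boxAlg (liftAlg lift) := by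
  refine Algebra.adjoin_le (S := (boxAlg (liftAlg lift)).comap
    (pullAlg k (Prod.map lift lift))) ?_ hc
  rintro _ (⟨f, hf, rfl⟩ | ⟨f, hf, rfl⟩)
  · have := mul_mem_boxAlg (mem_liftAlg (lift := lift).2 ⟨f, hf, fun _ => rfl⟩)
      (liftAlg lift).one_mem
    simp only [Pi.one_apply, mul_one] at this
    exact this
  · have := mul_mem_boxAlg (liftAlg lift).one_mem
      (mem_liftAlg (lift := lift).2 ⟨f, hf, fun _ => rfl⟩)
    simp only [Pi.one_apply, one_mul] at this
    exact this

theorem LinAlgGroup.regular₂_left {G : LinAlgGroup k} {c : G.points × G.points → k}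
    (hc : c ∈ G.regular₂) (y : G.points) : (fun x => c (x, y)) ∈ G.regular := by
  refine Algebra.adjoin_le (S := G.regular.comap (pullAlg k fun x => (x, y))) ?_ hc
  rintro _ (⟨f, hf, rfl⟩ | ⟨f, hf, rfl⟩)
  · exact hf
  · exact G.regular.algebraMap_mem (f y)

theorem LinAlgGroup.regular₂_right {G : LinAlgGroup k} {c : G.points × G.points → k}
    (hc : c ∈ G.regular₂) (x : G.points) : (fun y => c (x, y)) ∈ G.regular := by
  refine Algebra.adjoin_le (S := G.regular.comap (pullAlg k fun y => (x, y))) ?_ hc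
  rintro _ (⟨f, hf, rfl⟩ | ⟨f, hf, rfl⟩)
  · exact G.regular.algebraMap_mem (f x)
  · exact hf

/-- A regular cochain is a coboundary if this holds on a dense subgroup. -/
theorem HasDenseImage.eq_coboundary {G : LinAlgGroup k} {lift : Γ →* G.points}
    (hd : HasDenseImage lift) {c : G.points × G.points → k} (hc : c ∈ G.regular₂)
    {f : G.points → k} (hf : f ∈ G.regular)
    (h : ∀ x y, c (lift x, lift y) = f (lift y) - f (lift x * lift y) + f (lift x))
    (x y : G.points) : c (x, y) = f y - f (x * y) + f x := by
  have h1 (x : Γ) (y : G.points) :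
      c (lift x, y) = f y - f (lift x * y) + f (lift x) :=
    congrFun (hd.eq (LinAlgGroup.regular₂_right hc (lift x))
      (G.regular.add_mem (G.regular.sub_mem hf (LinAlgGroup.mul_left_mem hf (lift x)))
        (G.regular.algebraMap_mem (f (lift x)))) (h x)) y
  exact congrFun (hd.eq (LinAlgGroup.regular₂_left hc y)
    (G.regular.add_mem (G.regular.sub_mem (G.regular.algebraMap_mem (f y))
      (LinAlgGroup.mul_right_mem hf y)) hf) fun x => h1 x y) x

/-- A class which dies on `Γ` dies on a larger diagram. -/
theorem exists_transH2_eq_zero (hρ : Function.Surjective ρ) (α : Diagram S ρ) (z : α.E.H2)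
    (hz : resH2 α.lift z = 0) : ∃ (β : Diagram S ρ) (h : α ≤ β), transH2 S ρ α β h z = 0 := by
  induction z using Submodule.Quotient.induction_on with
  | H c =>
  obtain ⟨c, hc, hreg⟩ := c
  obtain ⟨f, hf⟩ := (groupCohomology.H2π_eq_zero_iff _).1 hz
  have hf (x y : Γ) : c (α.lift x, α.lift y) = f y - f (x * y) + f x :=
    (congrFun hf (x, y)).symm
  -- A priori f is an arbitrary function on Γ; β is built so that f becomes regular on it.
  obtain ⟨β, hβ⟩ := (α.isUnipotentHopf.adjoin_cochain (pull_regular₂ α.lift hreg)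
    hf).exists_diagram hρ
  have h : α ≤ β := Diagram.le_of_liftAlg_le (hβ ▸ le_sup_left)
  refine ⟨β, h, (Submodule.Quotient.mk_eq_zero _).2 ?_⟩
  have hfβ : f ∈ liftAlg β.lift :=
    hβ ▸ (le_sup_right : _ ≤ liftAlg α.lift ⊔ _) (Algebra.self_mem_adjoin_singleton k f)
  obtain ⟨F, hF, hFf⟩ := mem_liftAlg.1 hfβ
  have hcβ := pull₂_regular h.choose_spec.algebraic hreg
  refine ⟨F, hF, funext fun p => ?_⟩
  refine (β.dense.eq_coboundary hcβ hF (fun x y => ?_) p.1 p.2).symm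
  change c (h.choose (β.lift x), h.choose (β.lift y)) = _
  rw [h.choose_spec.map_lift, h.choose_spec.map_lift, hf, ← map_mul, hFf, hFf, hFf]

theorem restriction_injective (hρ : Function.Surjective ρ) :
    Function.Injective (restriction S ρ) := by
  classical
  have := Diagram.isDirectedOrder hρ
  have := Diagram.nonempty hρ
  intro x y hxy
  -- Directedness brings both classes to one diagram, where their difference dies on Γ.
  obtain ⟨α, z, w, rfl, rfl⟩ := Module.DirectLimit.exists_of₂ x y
  have e (z : α.E.H2) : restriction S ρ (Module.DirectLimit.of k _ _ (transH2 S ρ) α z) =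
      resH2 α.lift z := Module.DirectLimit.lift_of _ _ _
  rw [e, e] at hxy
  obtain ⟨β, h, hβ⟩ := exists_transH2_eq_zero hρ α (z - w) (by rw [map_sub, hxy, sub_self])
  rw [map_sub, sub_eq_zero] at hβ
  rw [← Module.DirectLimit.of_f (hij := h), hβ, Module.DirectLimit.of_f]

end Injectivity

end RelComp

end

theorem corollary5p4 {k Γ : Type u} [Field k] [Group Γ] (S : RelComp.LinAlgGroup k)
    (ρ : Γ →* S.points) (hsurj : Function.Surjective ρ)
    (hsplit : ∃ s : S.points →* Γ, ρ.comp s = MonoidHom.id S.points)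
    (hfin : Module.Finite k (groupHomology.H1 (Rep.trivial k ρ.ker k)))
    (hΦ : Function.Bijective (RelComp.Phi S ρ)) :
    Function.Injective (RelComp.restriction S ρ) :=
  RelComp.restriction_injective hsurj
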